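/- Let $\mathbb{CP}^2$ carry the Fubini–Study symplectic form $\omega$, normalized so that the total volume is $\pi^2/2$, and let $S^1$ act by $e^{i\theta}\cdot[z_0:z_1:z_2]=[z_0:z_1:e^{i\theta}z_2]$, with moment map $$\mu_2[z_0:z_1:z_2]=-\frac12\,\frac{|z_2|^2}{|z_0|^2+|z_1|^2+|z_2|^2}.$$ Identify the reduced space $M_{red}=\mu_2^{-1}(-\tfrac16)/S^1$ with $\mathbb{CP}^1$ by sending the orbit of $[z_0:z_1:z_2]$ to $[z_0:z_1]$, and let $\pi:\mu_2^{-1}(-\tfrac16)\to M_{red}$ be the projection. Let $\mu_{red}:M_{red}\to\mathbb{R}$ be the function induced by $$\mu_1[z_0:z_1:z_2]=-\frac12\,\frac{|z_1|^2}{|z_0|^2+|z_1|^2+|z_2|^2}.$$ A one-to-one transverse lifting of a subset $\ell\subset M_{red}$ is a compact embedded lagrangian submanifold $L\subset\mathbb{CP}^2$ that intersects the level set $\mu_2^{-1}(-\tfrac16)$ transversally and meets each $S^1$-orbit in that level set at most once, with $\ell=\pi\bigl(L\cap\mu_2^{-1}(-\tfrac16)\bigr)$. Then $$\mathcal{L}_2=\bigl\{[X-iY:\sqrt2\,iZ:X+iY]\;\bigm|\;X,Y,Z\in\mathbb{R},\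 X^2+Y^2+Z^2=1\bigr\}\subset\mathbb{CP}^2$$ is a one-to-one transverse lifting of a great circle $\ell_2$ in $M_{red}\simeq\mathbb{CP}^1$, where a great circle of $\mathbb{CP}^1$ means the intersection of the round sphere $S^2\simeq\mathbb{CP}^1$ with a plane through the origin, under the map $[z_0:z_1]\mapsto\bigl(2\operatorname{Re}(z_0\bar z_1),\,2\operatorname{Im}(z_0\bar z_1),\,|z_0|^2-|z_1|^2\bigr)/(|z_0|^2+|z_1|^2)$. Moreover $\mu_{red}(M_{red})=[-\tfrac13,0]$, and $\ell_2$ is the middle level set $\mu_{red}^{-1}(-\tfrac16)$. -/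

import Mathlib

open Set Topology
open scoped Manifold ContDiff

namespace ChiangLagrangian

noncomputable section

/-! ### Submanifolds, transversality, and liftings from a reduced space -/

section General

variable {E : Type*} [NormedAddCommGroup E] [NormedSpace ℝ E]
  {M : Type*} [TopologicalSpace M] [ChartedSpace E M]

/-- `S` is an embedded smooth submanifold of codimension `c` of the manifold `M`: near each of its
points it is the zero set of a smooth map to `ℝᶜ` that is a submersion along `S`. -/
def IsSmoothSubmanifold (E : Type*) [NormedAddCommGroup E] [NormedSpace ℝ E]
    {M : Type*} [TopologicalSpace M] [ChartedSpace E M] (c : ℕ) (S : Set M) : Prop :=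
  ∀ p ∈ S, ∃ (U : Set M) (F : M → Fin c → ℝ), IsOpen U ∧ p ∈ U ∧
    ContMDiffOn 𝓘(ℝ, E) 𝓘(ℝ, Fin c → ℝ) ∞ F U ∧
    (∀ q ∈ S ∩ U, Function.Surjective (mfderiv 𝓘(ℝ, E) 𝓘(ℝ, Fin c → ℝ) F q)) ∧
    S ∩ U = {q ∈ U | F q = 0}

/-- The tangent space at `p` of a submanifold `S` of `M`, as a subset of `T_p M`: all velocities
at `p` of smooth curves that run in `S`. -/
def tangentVectors (E : Type*) [NormedAddCommGroup E] [NormedSpace ℝ E]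
    {M : Type*} [TopologicalSpace M] [ChartedSpace E M] (S : Set M) (p : M) :
    Set (TangentSpace 𝓘(ℝ, E) p) :=
  {v | ∃ γ : ℝ → M, ContMDiff 𝓘(ℝ, ℝ) 𝓘(ℝ, E) ∞ γ ∧ (∀ t, γ t ∈ S) ∧
    ∃ h : γ 0 = p, h ▸ (mfderiv 𝓘(ℝ, ℝ) 𝓘(ℝ, E) γ 0 (1 : ℝ) : TangentSpace 𝓘(ℝ, E) (γ 0)) = v}

/-- `S` and `S'` are embedded submanifolds (of codimensions `c` and `c'`) that intersect
transversally: `T_p S + T_p S' = T_p M` at every common point `p`. -/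
def IntersectTransversally (E : Type*) [NormedAddCommGroup E] [NormedSpace ℝ E]
    {M : Type*} [TopologicalSpace M] [ChartedSpace E M] (c c' : ℕ) (S S' : Set M) : Prop :=
  IsSmoothSubmanifold E c S ∧ IsSmoothSubmanifold E c' S' ∧
    ∀ p ∈ S ∩ S', ∀ v : TangentSpace 𝓘(ℝ, E) p,
      ∃ u ∈ tangentVectors E S p, ∃ w ∈ tangentVectors E S' p, u + w = v

/-- `L` is a lagrangian submanifold for the 2-form `Ω`: an embedded submanifold of half the
dimension of `M` on whose tangent spaces `Ω` vanishes. -/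
def IsLagrangian (Ω : ∀ p : M, LinearMap.BilinForm ℝ (TangentSpace 𝓘(ℝ, E) p)) (L : Set M) :
    Prop :=
  (∃ c : ℕ, Module.finrank ℝ E = 2 * c ∧ IsSmoothSubmanifold E c L) ∧
    ∀ p ∈ L, ∀ u ∈ tangentVectors E L p, ∀ v ∈ tangentVectors E L p, Ω p u v = 0

/-- Two points of the level set `μ⁻¹(a)` are equivalent when they lie on one orbit of `G`. -/
def levelSetoid (G : Type*) [Group G] {M V : Type*} [MulAction G M] (μ : M → V) (a : V) :
    Setoid (μ ⁻¹' {a}) :=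
  (MulAction.orbitRel G M).comap Subtype.val

/-- The reduced space `μ⁻¹(a) / G`. -/
def ReducedSpace (G : Type*) [Group G] {M V : Type*} [MulAction G M] (μ : M → V) (a : V) : Type _ :=
  Quotient (levelSetoid G μ a)

/-- The point-orbit projection `π : μ⁻¹(a) → μ⁻¹(a) / G`. -/
def orbitProj (G : Type*) [Group G] {M V : Type*} [MulAction G M] (μ : M → V) (a : V) :
    μ ⁻¹' {a} → ReducedSpace G μ a :=
  Quotient.mk (levelSetoid G μ a)

/-- The quotient topology of the reduced space. -/
instance (G : Type*) [Group G] {M V : Type*} [TopologicalSpace M] [MulAction G M]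
    (μ : M → V) (a : V) : TopologicalSpace (ReducedSpace G μ a) :=
  inferInstanceAs (TopologicalSpace (Quotient (levelSetoid G μ a)))

/-- `L ⊆ M` is a one-to-one transverse lifting of the subset `ℓ` of the reduced space
`μ⁻¹(a) / G`: it is a compact lagrangian submanifold, it intersects the level set `μ⁻¹(a)`
transversally, it meets each orbit in the level set at most once, and `ℓ = π (L ∩ μ⁻¹(a))`. -/
structure IsOneToOneTransverseLifting {G : Type*} [Group G] [MulAction G M]
    {V : Type*} [AddCommGroup V] [Module ℝ V]
    (Ω : ∀ p : M, LinearMap.BilinForm ℝ (TangentSpace 𝓘(ℝ, E) p)) (μ : M → V) (a : V)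
    (L : Set M) (ℓ : Set (ReducedSpace G μ a)) : Prop where
  isCompact : IsCompact L
  isLagrangian : IsLagrangian Ω L
  transverse : IntersectTransversally E (Module.finrank ℝ E / 2) (Module.finrank ℝ V) L (μ ⁻¹' {a})
  injOn : InjOn (orbitProj G μ a) {x | (x : M) ∈ L}
  eq_image : ℓ = orbitProj G μ a '' {x | (x : M) ∈ L}

end General

/-! ### Complex projective space -/

/-- Complex projective `n`-space: the nonzero vectors of `ℂⁿ⁺¹` up to nonzero complex scalars. -/
def CP (n : ℕ) : Type := Projectivization ℂ (Fin (n + 1) → ℂ)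

namespace CP

variable {n : ℕ}

/-- The point `[v 0 : … : v n]`. -/
def mk (v : Fin (n + 1) → ℂ) (hv : v ≠ 0) : CP n := Projectivization.mk ℂ v hv

/-- Maps out of `CP n` are scaling invariant maps of homogeneous coordinates. -/
def lift {α : Type*} (f : (Fin (n + 1) → ℂ) → α)
    (hf : ∀ (v : Fin (n + 1) → ℂ) (t : ℂ), v ≠ 0 → t ≠ 0 → f (t • v) = f v) (p : CP n) : α :=
  Projectivization.lift (fun v => f v.1) (by
    rintro ⟨a, ha⟩ ⟨b, hb⟩ t h
    simp only at h ⊢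
    rw [h]
    refine hf b t hb ?_
    rintro rfl
    exact ha (by rw [h, zero_smul])) p

@[simp] theorem lift_mk {α : Type*} (f : (Fin (n + 1) → ℂ) → α)
    (hf : ∀ (v : Fin (n + 1) → ℂ) (t : ℂ), v ≠ 0 → t ≠ 0 → f (t • v) = f v)
    (v : Fin (n + 1) → ℂ) (hv : v ≠ 0) : lift f hf (mk v hv) = f v := rfl

@[elab_as_elim]
theorem ind {P : CP n → Prop} (h : ∀ v hv, P (mk v hv)) (p : CP n) : P p :=
  Projectivization.ind h p

theorem mk_eq_mk_iff (v w : Fin (n + 1) → ℂ) (hv : v ≠ 0) (hw : w ≠ 0) :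
    mk v hv = mk w hw ↔ ∃ t : ℂ, t • w = v :=
  Projectivization.mk_eq_mk_iff' ℂ v w hv hw

/-- The quotient topology. -/
instance : TopologicalSpace (CP n) :=
  inferInstanceAs (TopologicalSpace (Quotient (projectivizationSetoid ℂ (Fin (n + 1) → ℂ))))

theorem isQuotientMap_mk :
    IsQuotientMap (fun v : {v : Fin (n + 1) → ℂ // v ≠ 0} => (mk v.1 v.2 : CP n)) :=
  isQuotientMap_quot_mk

theorem continuous_mk :
    Continuous (fun v : {v : Fin (n + 1) → ℂ // v ≠ 0} => (mk v.1 v.2 : CP n)) :=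
  isQuotientMap_mk.continuous

/-- The affine domain `z_j ≠ 0`. -/
def affineDomain (j : Fin (n + 1)) : Set (CP n) :=
  {p | lift (fun v => v j ≠ 0) (by intro v t _ ht; simp [ht]) p}

theorem mk_mem_affineDomain (j : Fin (n + 1)) (v : Fin (n + 1) → ℂ) (hv : v ≠ 0) :
    mk v hv ∈ affineDomain j ↔ v j ≠ 0 := Iff.rfl

theorem isOpen_affineDomain (j : Fin (n + 1)) : IsOpen (affineDomain j : Set (CP n)) := by
  rw [← isQuotientMap_mk.isOpen_preimage]
  have : Continuous fun v : {v : Fin (n + 1) → ℂ // v ≠ 0} => v.1 j :=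
    (continuous_apply j).comp continuous_subtype_val
  exact isOpen_ne.preimage this

/-- The affine coordinates `z_i / z_j`, `i ≠ j`. -/
def affineCoord (j : Fin (n + 1)) : CP n → Fin n → ℂ :=
  lift (fun v i => v (j.succAbove i) / v j) (by
    intro v t _ ht
    funext i
    simp [mul_div_mul_left _ _ ht])

theorem insertNth_one_ne_zero (j : Fin (n + 1)) (w : Fin n → ℂ) :
    (j.insertNth (α := fun _ => ℂ) 1 w) ≠ 0 := by
  intro h
  have := congrFun h j
  simp at this

theorem continuous_insertNth_one (j : Fin (n + 1)) :
    Continuous fun w : Fin n → ℂ => (j.insertNth (α := fun _ => ℂ) 1 w) :=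
  continuous_const.finInsertNth j continuous_id

/-- The affine chart `[z] ↦ (z_i / z_j)_{i ≠ j}` on the domain `z_j ≠ 0`, with inverse
`w ↦ [w_0 : … : 1 : … : w_{n-1}]`. -/
def affineChart (j : Fin (n + 1)) : OpenPartialHomeomorph (CP n) (Fin n → ℂ) where
  toFun := affineCoord j
  invFun w := mk (j.insertNth (α := fun _ => ℂ) 1 w) (insertNth_one_ne_zero j w)
  source := affineDomain j
  target := univ
  map_source' _ _ := mem_univ _
  map_target' w _ := by
    rw [mk_mem_affineDomain]
    simp
  left_inv' p := by
    induction p using ind with | h v hv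
    intro h
    rw [mk_mem_affineDomain] at h
    rw [mk_eq_mk_iff]
    refine ⟨(v j)⁻¹, ?_⟩
    funext i
    refine Fin.succAboveCases j ?_ (fun i => ?_) i
    · simp [h]
    · simp [affineCoord, div_eq_inv_mul]
  right_inv' w _ := by
    funext i
    simp [affineCoord]
  open_source := isOpen_affineDomain j
  open_target := isOpen_univ
  continuousOn_toFun := by
    rw [continuousOn_iff_continuous_domRestrict]
    have hq := isQuotientMap_mk (n := n) |>.restrictPreimage_isOpen (isOpen_affineDomain j)
    rw [hq.continuous_iff]
    refine continuous_pi fun i => ?_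
    have hc : ∀ k : Fin (n + 1), Continuous fun v : ((fun v : {v : Fin (n + 1) → ℂ // v ≠ 0} =>
        (mk v.1 v.2 : CP n)) ⁻¹' affineDomain j) => v.1.1 k := fun k =>
      (continuous_apply k).comp (continuous_subtype_val.comp continuous_subtype_val)
    exact (hc (j.succAbove i)).div (hc j) (fun v => v.2)
  continuousOn_invFun :=
    (continuous_mk.comp ((continuous_insertNth_one j).subtype_mk
      (insertNth_one_ne_zero j))).continuousOn

theorem exists_mem_affineDomain (p : CP n) : ∃ j, p ∈ affineDomain j := by
  induction p using ind with | h v hv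
  exact Function.ne_iff.mp hv

/-- An index of a nonvanishing homogeneous coordinate of `p`. -/
def chartIndex (p : CP n) : Fin (n + 1) := (exists_mem_affineDomain p).choose

theorem mem_affineDomain_chartIndex (p : CP n) : p ∈ affineDomain (chartIndex p) :=
  (exists_mem_affineDomain p).choose_spec

/-- The standard atlas of affine charts. -/
instance : ChartedSpace (Fin n → ℂ) (CP n) where
  atlas := range affineChart
  chartAt p := affineChart (chartIndex p)
  mem_chart_source := mem_affineDomain_chartIndex
  chart_mem_atlas _ := mem_range_self _

/-- `CP n` is a smooth real manifold, of real dimension `2 n`. -/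
instance : IsManifold 𝓘(ℝ, Fin n → ℂ) ∞ (CP n) := by
  refine isManifold_of_contDiffOn _ _ _ ?_
  rintro _ _ ⟨j, rfl⟩ ⟨k, rfl⟩
  simp only [modelWithCornersSelf_coe, modelWithCornersSelf_coe_symm, Function.comp_id,
    Function.id_comp, preimage_id_eq, id_eq, range_id, inter_univ]
  have hs : ∀ i : Fin (n + 1), ContDiff ℝ ∞ fun w : Fin n → ℂ =>
      (j.insertNth (α := fun _ => ℂ) 1 w) i := by
    intro i
    refine Fin.succAboveCases j ?_ (fun i => ?_) i
    · simpa using contDiff_const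
    · simpa using contDiff_apply ℝ ℂ i
  rw [contDiffOn_pi]
  intro i
  have : ContDiffOn ℝ ∞ (fun w : Fin n → ℂ =>
      (j.insertNth (α := fun _ => ℂ) 1 w) (k.succAbove i) *
        ((j.insertNth (α := fun _ => ℂ) 1 w) k)⁻¹)
      ((affineChart j).symm.trans (affineChart k)).source := by
    refine (hs _).contDiffOn.mul ((hs k).contDiffOn.inv ?_)
    intro w hw
    exact hw.2
  exact this.congr fun w _ => div_eq_mul_inv _ _

end CP

/-! ### The Fubini–Study form and the toric moment maps -/

/-- The Fubini–Study form in homogeneous coordinates, at `z ∈ ℂⁿ⁺¹ ∖ {0}`: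
`Im (h(V, W) / |z|² - h(V, z) h(z, W) / |z|⁴)` with `h(V, W) = ∑ conj (V_k) W_k`.  On the unit
sphere, for vectors orthogonal to `z`, it is the standard form
`(i/2) ∑ dz_k ∧ d(conj z_k)`, so that `CPⁿ` has symplectic volume `πⁿ / n!`. -/
def homogeneousForm {n : ℕ} (z V W : Fin (n + 1) → ℂ) : ℝ :=
  ((star V ⬝ᵥ W) / (star z ⬝ᵥ z) - (star V ⬝ᵥ z) * (star z ⬝ᵥ W) / (star z ⬝ᵥ z) ^ 2).im

open scoped ComplexOrder in
/-- `homogeneousForm` descends to projective space: it is invariant under the changes of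
`(z, V, W)` that do not change the point `[z]` and the tangent vectors at `[z]` that `V` and `W`
represent. -/
theorem homogeneousForm_descends {n : ℕ} (z V W : Fin (n + 1) → ℂ) (hz : z ≠ 0) (t a b : ℂ)
    (ht : t ≠ 0) :
    homogeneousForm (t • z) (t • V + a • z) (t • W + b • z) = homogeneousForm z V W := by
  have hz' : star z ⬝ᵥ z ≠ 0 := by
    rwa [Ne, dotProduct_star_self_eq_zero]
  have hs : star t ≠ 0 := by simpa using ht
  unfold homogeneousForm
  congr 1
  simp only [star_add, star_smul, add_dotProduct, dotProduct_add, smul_dotProduct,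
    dotProduct_smul, smul_eq_mul]
  field_simp
  ring

theorem homogeneousForm_add_left {n : ℕ} (z V V' W : Fin (n + 1) → ℂ) :
    homogeneousForm z (V + V') W = homogeneousForm z V W + homogeneousForm z V' W := by
  unfold homogeneousForm
  rw [← Complex.add_im]
  congr 1
  simp only [star_add, add_dotProduct]
  ring

theorem homogeneousForm_add_right {n : ℕ} (z V W W' : Fin (n + 1) → ℂ) :
    homogeneousForm z V (W + W') = homogeneousForm z V W + homogeneousForm z V W' := by
  unfold homogeneousForm
  rw [← Complex.add_im]
  congr 1
  simp only [dotProduct_add]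
  ring

theorem homogeneousForm_smul_left {n : ℕ} (c : ℝ) (z V W : Fin (n + 1) → ℂ) :
    homogeneousForm z (c • V) W = c * homogeneousForm z V W := by
  unfold homogeneousForm
  rw [← Complex.im_ofReal_mul]
  congr 1
  simp only [star_smul, star_trivial, smul_dotProduct, Complex.real_smul]
  ring

theorem homogeneousForm_smul_right {n : ℕ} (c : ℝ) (z V W : Fin (n + 1) → ℂ) :
    homogeneousForm z V (c • W) = c * homogeneousForm z V W := by
  unfold homogeneousForm
  rw [← Complex.im_ofReal_mul]
  congr 1
  simp only [dotProduct_smul, Complex.real_smul]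
  ring

theorem insertNth_zero_add {n : ℕ} (j : Fin (n + 1)) (u v : Fin n → ℂ) :
    j.insertNth (α := fun _ => ℂ) 0 (u + v) =
      j.insertNth (α := fun _ => ℂ) 0 u + j.insertNth (α := fun _ => ℂ) 0 v := by
  funext i
  refine Fin.succAboveCases j ?_ (fun i => ?_) i <;> simp

theorem insertNth_zero_smul {n : ℕ} (j : Fin (n + 1)) (c : ℝ) (u : Fin n → ℂ) :
    j.insertNth (α := fun _ => ℂ) 0 (c • u) = c • j.insertNth (α := fun _ => ℂ) 0 u := by
  funext i
  refine Fin.succAboveCases j ?_ (fun i => ?_) i <;> simp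

/-- The Fubini–Study form in the `j`-th affine chart, at the point with affine coordinates `w`.
The inverse of the chart lifts to `w ↦ (w_0, …, 1, …, w_{n-1})`, whose derivative is
`u ↦ (u_0, …, 0, …, u_{n-1})`. -/
def affineForm {n : ℕ} (j : Fin (n + 1)) (w : Fin n → ℂ) : LinearMap.BilinForm ℝ (Fin n → ℂ) :=
  LinearMap.mk₂ ℝ (fun u v => homogeneousForm (j.insertNth (α := fun _ => ℂ) 1 w)
      (j.insertNth (α := fun _ => ℂ) 0 u) (j.insertNth (α := fun _ => ℂ) 0 v))
    (fun _ _ _ => by rw [insertNth_zero_add, homogeneousForm_add_left])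
    (fun _ _ _ => by rw [insertNth_zero_smul, homogeneousForm_smul_left]; rfl)
    (fun _ _ _ => by rw [insertNth_zero_add, homogeneousForm_add_right])
    (fun _ _ _ => by rw [insertNth_zero_smul, homogeneousForm_smul_right]; rfl)

/-- The Fubini–Study symplectic form on `CP n`.  The tangent space at `p` is read in the preferred
affine chart at `p`, that is, in `chartAt (Fin n → ℂ) p`. -/
def fubiniStudy (n : ℕ) (p : CP n) : LinearMap.BilinForm ℝ (TangentSpace 𝓘(ℝ, Fin n → ℂ) p) :=
  affineForm p.chartIndex (CP.affineChart p.chartIndex p)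

/-- The moment map `-(1/2) |z_j|² / ∑ |z_k|²` of the rotation of the `j`-th coordinate. -/
def moment {n : ℕ} (j : Fin (n + 1)) : CP n → ℝ :=
  CP.lift (fun z => -(1 / 2) * (‖z j‖ ^ 2 / ∑ k, ‖z k‖ ^ 2)) (by
    intro v t _ ht
    have : ‖t‖ ^ 2 ≠ 0 := by simpa using ht
    simp [mul_pow, ← Finset.mul_sum, mul_div_mul_left _ _ this])

/-! ### The second circle action on `CP 2` and its reduction at level `-1/6` -/

/-- `(z_0, z_1, z_2) ↦ (z_0, z_1, g z_2)`. -/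
def rotateLinear (g : Circle) : (Fin 3 → ℂ) →ₗ[ℂ] (Fin 3 → ℂ) where
  toFun v := ![v 0, v 1, g * v 2]
  map_add' v w := by
    funext i
    fin_cases i <;> simp [mul_add]
  map_smul' c v := by
    funext i
    fin_cases i <;> simp [mul_left_comm]

theorem rotateLinear_injective (g : Circle) : Function.Injective (rotateLinear g) := by
  intro v w h
  have h0 := congrFun h 0
  have h1 := congrFun h 1
  have h2 := congrFun h 2
  simp [rotateLinear] at h0 h1 h2
  funext i
  fin_cases i <;> assumption

theorem rotateLinear_ne_zero (g : Circle) {v : Fin 3 → ℂ} (hv : v ≠ 0) : rotateLinear g v ≠ 0 :=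
  fun h => hv (rotateLinear_injective g (by rw [h, map_zero]))

/-- The second circle action: `g • [z_0 : z_1 : z_2] = [z_0 : z_1 : g z_2]`. -/
instance : MulAction Circle (CP 2) where
  smul g p := Projectivization.map (rotateLinear g) (rotateLinear_injective g) p
  one_smul p := by
    induction p using CP.ind with | h v hv
    change CP.mk (rotateLinear 1 v) (rotateLinear_ne_zero 1 hv) = _
    congr 1
    funext i
    fin_cases i <;> simp [rotateLinear]
  mul_smul g g' p := by
    induction p using CP.ind with | h v hv
    change CP.mk (rotateLinear (g * g') v) (rotateLinear_ne_zero _ hv) =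
      CP.mk (rotateLinear g (rotateLinear g' v))
        (rotateLinear_ne_zero _ (rotateLinear_ne_zero _ hv))
    congr 1
    funext i
    fin_cases i <;> simp [rotateLinear, mul_assoc]

theorem smul_mk (g : Circle) (v : Fin 3 → ℂ) (hv : v ≠ 0) :
    g • CP.mk v hv = CP.mk (rotateLinear g v) (rotateLinear_ne_zero g hv) := rfl

/-- The moment map `μ₂ [z] = -(1/2) |z_2|² / |z|²` of the second circle action on `CP 2`. -/
abbrev mu2 : CP 2 → ℝ := moment 2

/-- The reduced space `μ₂⁻¹(-1/6) / S¹`. -/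
abbrev Reduced : Type := ReducedSpace Circle mu2 (-1 / 6)

theorem moment_one_smul (g : Circle) (p : CP 2) : moment 1 (g • p) = moment 1 p := by
  induction p using CP.ind with | h v hv
  have h0 : ∀ w : Fin 3 → ℂ, ∑ k : Fin (2 + 1), ‖w k‖ ^ 2 = ‖w 0‖ ^ 2 + ‖w 1‖ ^ 2 + ‖w 2‖ ^ 2 :=
    fun w => Fin.sum_univ_three _
  simp only [smul_mk, moment, CP.lift_mk]
  rw [h0, h0]
  simp [rotateLinear, Circle.norm_coe]

/-- The moment map `μ_red` on the reduced space that is induced by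
`μ₁ [z] = -(1/2) |z_1|² / |z|²`. -/
def muRed : Reduced → ℝ :=
  Quotient.lift (fun x => moment 1 x.1) (by
    rintro x y ⟨g, hg⟩
    change g • y.1 = x.1 at hg
    rw [← hg, moment_one_smul])

theorem level_iff (v : Fin 3 → ℂ) (hv : v ≠ 0) :
    CP.mk v hv ∈ mu2 ⁻¹' {-1 / 6} ↔ ‖v 0‖ ^ 2 + ‖v 1‖ ^ 2 = 2 * ‖v 2‖ ^ 2 := by
  have hpos : 0 < ‖v 0‖ ^ 2 + ‖v 1‖ ^ 2 + ‖v 2‖ ^ 2 := by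
    by_contra! h
    apply hv
    have h0 : ‖v 0‖ = 0 := by nlinarith [sq_nonneg ‖v 0‖, sq_nonneg ‖v 1‖, sq_nonneg ‖v 2‖]
    have h1 : ‖v 1‖ = 0 := by nlinarith [sq_nonneg ‖v 0‖, sq_nonneg ‖v 1‖, sq_nonneg ‖v 2‖]
    have h2 : ‖v 2‖ = 0 := by nlinarith [sq_nonneg ‖v 0‖, sq_nonneg ‖v 1‖, sq_nonneg ‖v 2‖]
    rw [norm_eq_zero] at h0 h1 h2
    funext i
    fin_cases i <;> assumption
  have h0 : ∑ k : Fin (2 + 1), ‖v k‖ ^ 2 = ‖v 0‖ ^ 2 + ‖v 1‖ ^ 2 + ‖v 2‖ ^ 2 :=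
    Fin.sum_univ_three _
  simp only [mem_preimage, mem_singleton_iff, moment, CP.lift_mk]
  rw [h0]
  field_simp
  constructor <;> intro h <;> linarith

/-- The projection `[z_0 : z_1 : z_2] ↦ [z_0 : z_1]`, with the value `[1 : 0]` at `[0 : 0 : 1]`,
where it is not defined. -/
def forgetLast : CP 2 → CP 1 :=
  CP.lift (fun v => if h : ![v 0, v 1] ≠ 0 then CP.mk ![v 0, v 1] h else
    CP.mk ![1, 0] (by simp)) (by
    intro v t _ ht
    by_cases h : ![v 0, v 1] = 0
    · have h' : ![(t • v) 0, (t • v) 1] = 0 := by simp_all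
      simp only [ne_eq, h, h', not_true_eq_false, dite_false]
    · have h' : ![(t • v) 0, (t • v) 1] ≠ 0 := by simpa [ht] using h
      rw [dif_pos h', dif_pos h, CP.mk_eq_mk_iff]
      exact ⟨t, by simp⟩)

theorem head_ne_zero_of_level (v : Fin 3 → ℂ) (hv : v ≠ 0)
    (h : CP.mk v hv ∈ mu2 ⁻¹' {-1 / 6}) : ![v 0, v 1] ≠ 0 := by
  intro h'
  have h0 : v 0 = 0 := congrFun h' 0
  have h1 : v 1 = 0 := congrFun h' 1
  rw [level_iff] at h
  have h2 : v 2 = 0 := by simpa [h0, h1] using h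
  apply hv
  funext i
  fin_cases i <;> assumption

theorem forgetLast_mk (v : Fin 3 → ℂ) (hv : v ≠ 0) (h : ![v 0, v 1] ≠ 0) :
    forgetLast (CP.mk v hv) = CP.mk ![v 0, v 1] h := by
  simp only [forgetLast, CP.lift_mk]
  rw [dif_pos h]

theorem mk_mem_forgetDomain (v : Fin 3 → ℂ) (hv : v ≠ 0) (h : ![v 0, v 1] ≠ 0) :
    CP.mk v hv ∈ (CP.affineDomain 0 ∪ CP.affineDomain 1 : Set (CP 2)) := by
  by_contra h'
  simp only [mem_union, CP.mk_mem_affineDomain, not_or, not_not] at h'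
  exact h (by simp [h'.1, h'.2])

theorem head_ne_zero_of_mem (v : Fin 3 → ℂ) (hv : v ≠ 0)
    (h : CP.mk v hv ∈ (CP.affineDomain 0 ∪ CP.affineDomain 1 : Set (CP 2))) :
    ![v 0, v 1] ≠ 0 := by
  intro h'
  rcases h with h | h
  · exact h (congrFun h' 0)
  · exact h (congrFun h' 1)

theorem continuousOn_forgetLast :
    ContinuousOn forgetLast (CP.affineDomain 0 ∪ CP.affineDomain 1) := by
  rw [continuousOn_iff_continuous_domRestrict]
  have hq := (CP.isQuotientMap_mk (n := 2)).restrictPreimage_isOpen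
    ((CP.isOpen_affineDomain 0).union (CP.isOpen_affineDomain 1))
  rw [hq.continuous_iff]
  have hc : ∀ k : Fin 3, Continuous fun v : ((fun v : {v : Fin 3 → ℂ // v ≠ 0} =>
      (CP.mk v.1 v.2 : CP 2)) ⁻¹' (CP.affineDomain 0 ∪ CP.affineDomain 1)) => v.1.1 k := fun k =>
    (continuous_apply k).comp (continuous_subtype_val.comp continuous_subtype_val)
  have hc' : Continuous fun v : ((fun v : {v : Fin 3 → ℂ // v ≠ 0} =>
      (CP.mk v.1 v.2 : CP 2)) ⁻¹' (CP.affineDomain 0 ∪ CP.affineDomain 1)) =>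
      ![v.1.1 0, v.1.1 1] := by
    refine continuous_pi fun i => ?_
    fin_cases i
    · exact hc 0
    · exact hc 1
  convert CP.continuous_mk.comp (hc'.subtype_mk fun v =>
    head_ne_zero_of_mem v.1.1 v.1.2 v.2) using 1
  funext v
  exact forgetLast_mk v.1.1 v.1.2 (head_ne_zero_of_mem v.1.1 v.1.2 v.2)

/-- The lift `(w_0, w_1) ↦ (w_0, w_1, ((|w_0|² + |w_1|²) / 2)^{1/2})` to the level set. -/
def levelVec (w : Fin 2 → ℂ) : Fin 3 → ℂ :=
  ![w 0, w 1, (Real.sqrt ((‖w 0‖ ^ 2 + ‖w 1‖ ^ 2) / 2) : ℝ)]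

theorem levelVec_ne_zero {w : Fin 2 → ℂ} (hw : w ≠ 0) : levelVec w ≠ 0 := by
  intro h
  apply hw
  have h0 : w 0 = 0 := congrFun h 0
  have h1 : w 1 = 0 := congrFun h 1
  funext i
  fin_cases i <;> assumption

theorem levelVec_mem {w : Fin 2 → ℂ} (hw : w ≠ 0) :
    CP.mk (levelVec w) (levelVec_ne_zero hw) ∈ mu2 ⁻¹' {-1 / 6} := by
  rw [level_iff]
  have : 0 ≤ (‖w 0‖ ^ 2 + ‖w 1‖ ^ 2) / 2 := by positivity
  have h2 : ‖levelVec w 2‖ ^ 2 = (‖w 0‖ ^ 2 + ‖w 1‖ ^ 2) / 2 := by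
    change ‖((Real.sqrt ((‖w 0‖ ^ 2 + ‖w 1‖ ^ 2) / 2) : ℝ) : ℂ)‖ ^ 2 = _
    rw [Complex.norm_real, Real.norm_eq_abs, sq_abs, Real.sq_sqrt this]
  rw [h2]
  change ‖w 0‖ ^ 2 + ‖w 1‖ ^ 2 = _
  ring

/-- Points of the level set with the same image in `CP 1` lie on one circle orbit. -/
theorem exists_rotate {v w : Fin 3 → ℂ} (hv : v ≠ 0) (hw : w ≠ 0)
    (hvl : CP.mk v hv ∈ mu2 ⁻¹' {-1 / 6}) (hwl : CP.mk w hw ∈ mu2 ⁻¹' {-1 / 6})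
    (t : ℂ) (ht : t ≠ 0) (h0 : v 0 = t * w 0) (h1 : v 1 = t * w 1) :
    ∃ g : Circle, g • CP.mk w hw = CP.mk v hv := by
  have hw2 : w 2 ≠ 0 := by
    intro h
    rw [level_iff, h] at hwl
    have hh := head_ne_zero_of_level w hw (by rw [level_iff, h]; exact hwl)
    apply hh
    have a0 : ‖w 0‖ = 0 := by
      simp at hwl
      nlinarith [sq_nonneg ‖w 0‖, sq_nonneg ‖w 1‖]
    have a1 : ‖w 1‖ = 0 := by
      simp at hwl
      nlinarith [sq_nonneg ‖w 0‖, sq_nonneg ‖w 1‖]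
    rw [norm_eq_zero] at a0 a1
    simp [a0, a1]
  rw [level_iff] at hvl hwl
  have hn : ‖v 2‖ = ‖t * w 2‖ := by
    rw [h0, h1, norm_mul, norm_mul, mul_pow, mul_pow, ← mul_add, hwl] at hvl
    rw [← sq_eq_sq₀ (norm_nonneg _) (norm_nonneg _), norm_mul, mul_pow]
    linarith
  have htw : t * w 2 ≠ 0 := mul_ne_zero ht hw2
  have hg : v 2 / (t * w 2) ∈ Submonoid.unitSphere ℂ := by
    change _ ∈ Metric.sphere (0 : ℂ) 1
    rw [mem_sphere_zero_iff_norm, norm_div, hn, div_self (norm_ne_zero_iff.mpr htw)]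
  let g : Circle := ⟨v 2 / (t * w 2), hg⟩
  have hgc : (g : ℂ) = v 2 / (t * w 2) := rfl
  refine ⟨g, ?_⟩
  rw [smul_mk, CP.mk_eq_mk_iff]
  refine ⟨t⁻¹, ?_⟩
  funext i
  fin_cases i
  · simp [rotateLinear, h0, ht]
  · simp [rotateLinear, h1, ht]
  · simp [rotateLinear, hgc]
    field_simp

/-- The identification of the reduced space with `CP 1`: the orbit of `[z_0 : z_1 : z_2]` in the
level set corresponds to `[z_0 : z_1]`. -/
def reducedHomeomorph : Reduced ≃ₜ CP 1 where
  toFun := Quotient.lift (fun x => forgetLast x.1) (by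
    rintro ⟨p, hp⟩ ⟨q, hq⟩ ⟨g, hg⟩
    change g • q = p at hg
    change forgetLast p = forgetLast q
    subst hg
    induction q using CP.ind with | h v hv
    rw [smul_mk]
    rfl)
  invFun := CP.lift (fun w => if hw : w ≠ 0 then
      orbitProj Circle mu2 (-1 / 6) ⟨CP.mk (levelVec w) (levelVec_ne_zero hw), levelVec_mem hw⟩
      else orbitProj Circle mu2 (-1 / 6) ⟨CP.mk (levelVec 1) (levelVec_ne_zero one_ne_zero),
        levelVec_mem one_ne_zero⟩) (by
    intro w t hw ht
    have hw' : t • w ≠ 0 := smul_ne_zero ht hw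
    rw [dif_pos hw, dif_pos hw']
    apply Quotient.sound
    obtain ⟨g, hg⟩ := exists_rotate (levelVec_ne_zero hw') (levelVec_ne_zero hw)
      (levelVec_mem hw') (levelVec_mem hw) t ht rfl rfl
    exact ⟨g, hg⟩)
  left_inv := by
    rintro ⟨⟨p, hp⟩⟩
    induction p using CP.ind with | h v hv
    have h := head_ne_zero_of_level v hv hp
    change CP.lift _ _ (forgetLast (CP.mk v hv)) = _
    rw [forgetLast_mk v hv h, CP.lift_mk, dif_pos h]
    apply Quotient.sound
    obtain ⟨g, hg⟩ := exists_rotate (levelVec_ne_zero h) hv (levelVec_mem h) hp 1 one_ne_zero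
      (by simp [levelVec]) (by simp [levelVec])
    exact ⟨g, hg⟩
  right_inv := by
    intro p
    induction p using CP.ind with | h w hw
    rw [CP.lift_mk, dif_pos hw]
    change forgetLast (CP.mk (levelVec w) _) = _
    have : ![levelVec w 0, levelVec w 1] = w := by
      funext i
      fin_cases i <;> rfl
    rw [forgetLast_mk _ _ (by rwa [this])]
    congr 1
  continuous_toFun := by
    refine continuous_quot_lift _ (continuousOn_forgetLast.comp_continuous
      continuous_subtype_val ?_)
    rintro ⟨p, hp⟩
    induction p using CP.ind with | h v hv
    exact mk_mem_forgetDomain v hv (head_ne_zero_of_level v hv hp)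
  continuous_invFun := by
    rw [CP.isQuotientMap_mk.continuous_iff]
    have hl : Continuous fun w : {w : Fin 2 → ℂ // w ≠ 0} => levelVec w.1 := by
      have h0 : Continuous fun w : {w : Fin 2 → ℂ // w ≠ 0} => w.1 0 :=
        (continuous_apply 0).comp continuous_subtype_val
      have h1 : Continuous fun w : {w : Fin 2 → ℂ // w ≠ 0} => w.1 1 :=
        (continuous_apply 1).comp continuous_subtype_val
      refine continuous_pi fun i => ?_
      fin_cases i
      · exact h0
      · exact h1
      · exact Complex.continuous_ofReal.comp (Real.continuous_sqrt.comp
          (((h0.norm.pow 2).add (h1.norm.pow 2)).div_const 2))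
    have hc : Continuous fun w : {w : Fin 2 → ℂ // w ≠ 0} =>
        orbitProj Circle mu2 (-1 / 6)
          ⟨CP.mk (levelVec w.1) (levelVec_ne_zero w.2), levelVec_mem w.2⟩ :=
      continuous_quot_mk.comp ((CP.continuous_mk.comp
        (hl.subtype_mk fun w => levelVec_ne_zero w.2)).subtype_mk fun w => levelVec_mem w.2)
    convert hc using 1
    funext w
    simp only [Function.comp_apply, CP.lift_mk]
    rw [dif_pos w.2]

/-- The Hopf map `CP 1 → S² ⊆ ℝ³`,
`[z_0 : z_1] ↦ (2 Re (z_0 conj z_1), 2 Im (z_0 conj z_1), |z_0|² - |z_1|²) / (|z_0|² + |z_1|²)`,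
which identifies `CP 1` with its Fubini–Study metric with a round sphere, up to scale. -/
def hopf : CP 1 → EuclideanSpace ℝ (Fin 3) :=
  CP.lift (fun z => (‖z 0‖ ^ 2 + ‖z 1‖ ^ 2)⁻¹ • !₂[2 * (z 0 * star (z 1)).re,
    2 * (z 0 * star (z 1)).im, ‖z 0‖ ^ 2 - ‖z 1‖ ^ 2]) (by
    intro v t _ ht
    have hn : ‖t‖ ^ 2 ≠ 0 := by simpa using ht
    have hx : ((t • v) 0 * star ((t • v) 1)) = ((‖t‖ ^ 2 : ℝ) : ℂ) * (v 0 * star (v 1)) := by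
      have : t * star t = ((‖t‖ ^ 2 : ℝ) : ℂ) := by
        rw [Complex.ofReal_pow]
        exact Complex.mul_conj' t
      rw [← this]
      simp only [Pi.smul_apply, smul_eq_mul, star_mul']
      ring
    rw [hx]
    simp only [Pi.smul_apply, smul_eq_mul, norm_mul, mul_pow, Complex.re_ofReal_mul,
      Complex.im_ofReal_mul, ← mul_add, ← mul_sub, mul_inv]
    ext i
    fin_cases i <;> simp <;> field_simp)

/-- A great circle of `CP 1`: the points of the round sphere on a plane through the origin. -/
def IsGreatCircle (S : Set (CP 1)) : Prop :=
  ∃ n : EuclideanSpace ℝ (Fin 3), n ≠ 0 ∧ S = {p | inner ℝ n (hopf p) = 0}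

/-- The vector `(X - iY, √2 i Z, X + iY)`. -/
def lagrangianVec (X Y Z : ℝ) : Fin 3 → ℂ :=
  ![X - Complex.I * Y, (Real.sqrt 2 : ℝ) * Complex.I * Z, X + Complex.I * Y]

theorem lagrangianVec_ne_zero {X Y Z : ℝ} (h : X ^ 2 + Y ^ 2 + Z ^ 2 = 1) :
    lagrangianVec X Y Z ≠ 0 := by
  intro h'
  have h1 := congrFun h' 1
  have h2 := congrArg Complex.re (congrFun h' 2)
  have h3 := congrArg Complex.im (congrFun h' 2)
  simp [lagrangianVec] at h1 h2 h3
  simp [h1, h2, h3] at h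

/-- `{[X - iY : √2 i Z : X + iY] | X² + Y² + Z² = 1}`. -/
def lagrangianL2 : Set (CP 2) :=
  {p | ∃ (X Y Z : ℝ) (h : X ^ 2 + Y ^ 2 + Z ^ 2 = 1),
    p = CP.mk (lagrangianVec X Y Z) (lagrangianVec_ne_zero h)}

end

end ChiangLagrangian

open ChiangLagrangian

/-! The linear map `realFrame` is √2 times a unitary map and carries ℝP² onto the set in question.
Hermitian products of real vectors are real (`star_realFrame_dotProduct`), so the Fubini–Study form,
an imaginary part of such products, vanishes on tangent vectors: the surface is lagrangian.

A real representative satisfies z₀ = conj z₂ and conj z₁ = -z₁. Hence every point of the surface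
satisfies |z₀| = |z₂| and z₀ conj z₁ + z₁ conj z₂ = 0, in any homogeneous coordinates. On the level
set |z₀|² + |z₁|² = 2|z₂|² this forces |z₀| = |z₁| = |z₂| ≠ 0, and the second equation then
determines z₂ from z₀ and z₁. So an orbit is met at most once, and only over |z₀| = |z₁|.
Conversely, over each such [z₀ : z₁] the value of z₂ solving the equation has the right modulus
(`image_lagrangianL2_eq`). The circle |z₀| = |z₁| is the equator under the Hopf map and the middle
level of `muRed`, which equals -(1/3)|z₁|²/(|z₀|² + |z₁|²).

Transversality needs only one tangent direction of the surface along which `mu2` has nonzero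
derivative, because the level set is a hypersurface; varying Z provides it
(`intersectTransversally_lagrangianL2`).

The differential geometry is done in homogeneous coordinates. The map `ofVec` is a submersion with
smooth local sections, and it pulls the Fubini–Study form back to `homogeneousForm`
(`fubiniStudy_ofVecDeriv`), so no later computation uses the affine charts. -/

namespace ChiangLagrangian

noncomputable section

/-! ### The quotient map from homogeneous coordinates and its derivative -/

namespace CP

variable {n : ℕ}

/-- The point with homogeneous coordinates `v`, with a junk value at `v = 0`. -/
def ofVec (v : Fin (n + 1) → ℂ) : CP n :=
  open Classical in if h : v ≠ 0 then mk v h else mk 1 one_ne_zero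

theorem ofVec_of_ne_zero {v : Fin (n + 1) → ℂ} (hv : v ≠ 0) : ofVec v = mk v hv :=
  dif_pos hv

theorem exists_eq_ofVec (p : CP n) : ∃ v, v ≠ 0 ∧ ofVec v = p := by
  induction p using ind with | h v hv
  exact ⟨v, hv, ofVec_of_ne_zero hv⟩

theorem ofVec_smul {c : ℂ} (hc : c ≠ 0) {v : Fin (n + 1) → ℂ} (hv : v ≠ 0) :
    ofVec (c • v) = ofVec v := by
  rw [ofVec_of_ne_zero hv, ofVec_of_ne_zero (smul_ne_zero hc hv), mk_eq_mk_iff]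
  exact ⟨c, rfl⟩

theorem lift_ofVec {α : Type*} (f : (Fin (n + 1) → ℂ) → α)
    (hf : ∀ (v : Fin (n + 1) → ℂ) (t : ℂ), v ≠ 0 → t ≠ 0 → f (t • v) = f v)
    {v : Fin (n + 1) → ℂ} (hv : v ≠ 0) : lift f hf (ofVec v) = f v := by
  rw [ofVec_of_ne_zero hv, lift_mk]

theorem ofVec_mem_affineDomain {v : Fin (n + 1) → ℂ} (hv : v ≠ 0) (j : Fin (n + 1)) :
    ofVec v ∈ affineDomain j ↔ v j ≠ 0 := by
  rw [ofVec_of_ne_zero hv, mk_mem_affineDomain]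

theorem affineChart_ofVec {v : Fin (n + 1) → ℂ} (hv : v ≠ 0) (j : Fin (n + 1)) :
    affineChart j (ofVec v) = fun i => v (j.succAbove i) / v j := by
  rw [ofVec_of_ne_zero hv]
  rfl

theorem continuousAt_ofVec {v : Fin (n + 1) → ℂ} (hv : v ≠ 0) :
    ContinuousAt (ofVec : (Fin (n + 1) → ℂ) → CP n) v := by
  have hc : ContinuousOn (ofVec : (Fin (n + 1) → ℂ) → CP n) {v | v ≠ 0} := by
    rw [continuousOn_iff_continuous_domRestrict]
    refine (continuous_mk (n := n)).congr fun v => ?_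
    exact (ofVec_of_ne_zero v.2).symm
  exact hc.continuousAt (isOpen_ne.mem_nhds hv)

/-- The index of the preferred affine chart at the point `[v]`. -/
def chartIndexOf (v : Fin (n + 1) → ℂ) : Fin (n + 1) := chartIndex (ofVec v)

theorem apply_chartIndexOf_ne_zero {v : Fin (n + 1) → ℂ} (hv : v ≠ 0) :
    v (chartIndexOf v) ≠ 0 :=
  (ofVec_mem_affineDomain hv _).1 (mem_affineDomain_chartIndex _)

theorem contDiffAt_affineQuotient {v : Fin (n + 1) → ℂ} {j : Fin (n + 1)} (hj : v j ≠ 0) :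
    ContDiffAt ℝ ∞ (fun (w : Fin (n + 1) → ℂ) (i : Fin n) => w (j.succAbove i) / w j) v := by
  rw [contDiffAt_pi]
  intro i
  simp only [div_eq_mul_inv]
  exact (contDiff_apply ℝ ℂ _).contDiffAt.mul ((contDiff_apply ℝ ℂ j).contDiffAt.inv hj)

theorem affineChart_comp_ofVec_eventuallyEq {v : Fin (n + 1) → ℂ} (hv : v ≠ 0)
    (j : Fin (n + 1)) :
    (fun w => affineChart j (ofVec w)) =ᶠ[𝓝 v] fun w i => w (j.succAbove i) / w j := by
  filter_upwards [isOpen_ne.mem_nhds hv] with w hw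
  exact affineChart_ofVec hw j

theorem contMDiffAt_ofVec {v : Fin (n + 1) → ℂ} (hv : v ≠ 0) :
    ContMDiffAt 𝓘(ℝ, Fin (n + 1) → ℂ) 𝓘(ℝ, Fin n → ℂ) ∞ (ofVec : (Fin (n + 1) → ℂ) → CP n) v := by
  rw [contMDiffAt_iff]
  refine ⟨continuousAt_ofVec hv, ?_⟩
  simp only [mfld_simps, contDiffWithinAt_univ]
  exact (contDiffAt_affineQuotient (apply_chartIndexOf_ne_zero hv)).congr_of_eventuallyEq
    (affineChart_comp_ofVec_eventuallyEq hv _)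

/-- The derivative of `ofVec` at `v`, read in the preferred chart at `[v]`. -/
def ofVecDeriv (v : Fin (n + 1) → ℂ) : (Fin (n + 1) → ℂ) →L[ℝ] (Fin n → ℂ) :=
  mfderiv 𝓘(ℝ, Fin (n + 1) → ℂ) 𝓘(ℝ, Fin n → ℂ) (ofVec : (Fin (n + 1) → ℂ) → CP n) v

theorem mdifferentiableAt_ofVec {v : Fin (n + 1) → ℂ} (hv : v ≠ 0) :
    MDifferentiableAt 𝓘(ℝ, Fin (n + 1) → ℂ) 𝓘(ℝ, Fin n → ℂ)
      (ofVec : (Fin (n + 1) → ℂ) → CP n) v :=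
  (contMDiffAt_ofVec hv).mdifferentiableAt (by simp)

theorem ofVecDeriv_eq_fderiv {v : Fin (n + 1) → ℂ} (hv : v ≠ 0) :
    ofVecDeriv v = fderiv ℝ (fun (w : Fin (n + 1) → ℂ) (i : Fin n) =>
      w ((chartIndexOf v).succAbove i) / w (chartIndexOf v)) v := by
  have h := (mdifferentiableAt_ofVec hv).mfderiv
  simp only [mfld_simps, fderivWithin_univ] at h
  refine h.trans ?_
  exact (affineChart_comp_ofVec_eventuallyEq hv (chartIndexOf v)).fderiv_eq

/-- The quotient rule for w_i / w_j at the preferred index j, obtained by differentiating along the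
line v + tV. -/
theorem ofVecDeriv_apply {v : Fin (n + 1) → ℂ} (hv : v ≠ 0) (V : Fin (n + 1) → ℂ) (i : Fin n) :
    ofVecDeriv v V i = (V ((chartIndexOf v).succAbove i) -
      v ((chartIndexOf v).succAbove i) / v (chartIndexOf v) * V (chartIndexOf v)) /
        v (chartIndexOf v) := by
  have hj := apply_chartIndexOf_ne_zero hv
  set j := chartIndexOf v
  have hd := (contDiffAt_affineQuotient hj).differentiableAt (n := ∞) (by simp)
  rw [ofVecDeriv_eq_fderiv hv]
  have h1 := hasDerivAt_pi.1 (hd.hasFDerivAt.hasLineDerivAt V) i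
  have h2 : ∀ k : Fin (n + 1), HasDerivAt (fun t : ℝ => (v + t • V) k) (V k) 0 := fun k => by
    simpa using ((hasDerivAt_id (0 : ℝ)).smul_const (V k)).const_add (v k)
  refine (h1.unique ((h2 (j.succAbove i)).fun_div (h2 j) (by simpa using hj))).trans ?_
  simp
  field_simp

/-- Complex multiples of v are tangent to the fibre of `ofVec`, so a representative V may be changed
by any multiple of v. -/
theorem ofVecDeriv_smul_self {v : Fin (n + 1) → ℂ} (hv : v ≠ 0) (c : ℂ) :
    ofVecDeriv v (c • v) = 0 := by
  have hj := apply_chartIndexOf_ne_zero hv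
  funext i
  rw [ofVecDeriv_apply hv]
  simp
  field_simp
  simp

theorem fubiniStudy_ofVecDeriv {v : Fin (n + 1) → ℂ} (hv : v ≠ 0) (V W : Fin (n + 1) → ℂ) :
    fubiniStudy n (ofVec v) (ofVecDeriv v V) (ofVecDeriv v W) = homogeneousForm v V W := by
  have hj := apply_chartIndexOf_ne_zero hv
  -- The chart represents the point by v / v_j, and the vector by V / v_j plus a multiple of v.
  -- These are exactly the changes allowed by `homogeneousForm_descends`.
  have h0 : ∀ V, (chartIndexOf v).insertNth (α := fun _ => ℂ) 0 (ofVecDeriv v V) =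
      (v (chartIndexOf v))⁻¹ • V + (-(V (chartIndexOf v) / v (chartIndexOf v) ^ 2)) • v := by
    intro V
    funext i
    refine Fin.succAboveCases (chartIndexOf v) ?_ (fun i => ?_) i
    · simp
      field_simp
      simp
    · simp [ofVecDeriv_apply hv]
      field_simp
      ring
  have h1 : (chartIndexOf v).insertNth (α := fun _ => ℂ) 1
      (affineChart (chartIndexOf v) (ofVec v)) = (v (chartIndexOf v))⁻¹ • v := by
    rw [affineChart_ofVec hv]
    funext i
    refine Fin.succAboveCases (chartIndexOf v) ?_ (fun i => ?_) i
    · simp [hj]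
    · simp [div_eq_inv_mul]
  change homogeneousForm ((chartIndexOf v).insertNth (α := fun _ => ℂ) 1
      (affineChart (chartIndexOf v) (ofVec v))) ((chartIndexOf v).insertNth 0 (ofVecDeriv v V))
      ((chartIndexOf v).insertNth 0 (ofVecDeriv v W)) = _
  rw [h0, h0, h1, homogeneousForm_descends _ _ _ hv _ _ _ (inv_ne_zero hj)]

/-- The section `[w] ↦ (v_j / w_j) w` of `ofVec` through `v`, for an index `j` with `v_j ≠ 0`. -/
def localSection (v : Fin (n + 1) → ℂ) (p : CP n) : Fin (n + 1) → ℂ :=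
  v (chartIndexOf v) •
    (chartIndexOf v).insertNth (α := fun _ => ℂ) 1 (affineChart (chartIndexOf v) p)

theorem localSection_ofVec {v : Fin (n + 1) → ℂ} (hv : v ≠ 0) :
    localSection v (ofVec v) = v := by
  have hj := apply_chartIndexOf_ne_zero hv
  rw [localSection, affineChart_ofVec hv]
  funext i
  refine Fin.succAboveCases (chartIndexOf v) ?_ (fun i => ?_) i
  · simp
  · simp
    field_simp

theorem ofVec_localSection {v : Fin (n + 1) → ℂ} (hv : v ≠ 0) {p : CP n}
    (hp : p ∈ affineDomain (chartIndexOf v)) : ofVec (localSection v p) = p := by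
  rw [localSection, ofVec_smul (apply_chartIndexOf_ne_zero hv) (insertNth_one_ne_zero _ _),
    ofVec_of_ne_zero (insertNth_one_ne_zero _ _)]
  exact (affineChart (chartIndexOf v)).left_inv hp

theorem ofVec_localSection_eventuallyEq {v : Fin (n + 1) → ℂ} (hv : v ≠ 0) :
    ofVec ∘ localSection v =ᶠ[𝓝 (ofVec v)] id := by
  filter_upwards [(isOpen_affineDomain _).mem_nhds (mem_affineDomain_chartIndex (ofVec v))]
    with p hp
  exact ofVec_localSection hv hp

theorem contMDiffAt_localSection {v : Fin (n + 1) → ℂ} :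
    ContMDiffAt 𝓘(ℝ, Fin n → ℂ) 𝓘(ℝ, Fin (n + 1) → ℂ) ∞ (localSection v) (ofVec v) := by
  have hs : ContDiff ℝ ∞ fun w : Fin n → ℂ =>
      v (chartIndexOf v) • (chartIndexOf v).insertNth (α := fun _ => ℂ) 1 w := by
    refine ContDiff.const_smul _ ?_
    rw [contDiff_pi]
    intro i
    refine Fin.succAboveCases (chartIndexOf v) ?_ (fun i => ?_) i
    · simpa using contDiff_const
    · simpa using contDiff_apply ℝ ℂ i
  exact hs.contMDiff.contMDiffAt.comp _
    (contMDiffAt_extChartAt (I := 𝓘(ℝ, Fin n → ℂ)) (n := ∞) (x := ofVec v))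

/-- The derivative of `localSection` is a right inverse. -/
theorem ofVecDeriv_surjective {v : Fin (n + 1) → ℂ} (hv : v ≠ 0) :
    Function.Surjective (ofVecDeriv v) := by
  intro u
  have hs := (contMDiffAt_localSection (v := v)).mdifferentiableAt (by simp)
  have h := mfderiv_comp_of_eq (x := ofVec v) (mdifferentiableAt_ofVec hv) hs
    (localSection_ofVec hv)
  rw [(ofVec_localSection_eventuallyEq hv).mfderiv_eq, mfderiv_id] at h
  have h' := congrArg (fun A => A u) h
  obtain ⟨w, hw⟩ : ∃ w, ofVecDeriv (localSection v (ofVec v)) w = u := ⟨_, h'.symm⟩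
  rw [localSection_ofVec hv] at hw
  exact ⟨w, hw⟩

/-! ### Smooth functions and curves read through homogeneous coordinates -/

variable {V : Type*} [NormedAddCommGroup V] [NormedSpace ℝ V]

/-- Near [v], F is the composite of F ∘ `ofVec` with the smooth `localSection`. -/
theorem contMDiffAt_of_comp_ofVec {F : CP n → V} {v : Fin (n + 1) → ℂ} (hv : v ≠ 0)
    (hF : ContDiffAt ℝ ∞ (fun w => F (ofVec w)) v) :
    ContMDiffAt 𝓘(ℝ, Fin n → ℂ) 𝓘(ℝ, V) ∞ F (ofVec v) := by
  have h := ContMDiffAt.comp_of_eq (x := ofVec v) hF.contMDiffAt contMDiffAt_localSection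
    (localSection_ofVec hv)
  refine h.congr_of_eventuallyEq ?_
  filter_upwards [ofVec_localSection_eventuallyEq hv] with p hp
  exact (congrArg F hp).symm

/-- By the chain rule the derivative of F ∘ `ofVec` factors through that of F, so differentiating
along straight lines of homogeneous coordinates suffices. -/
theorem surjective_mfderiv_of_lines {F : CP n → V} {v : Fin (n + 1) → ℂ} (hv : v ≠ 0)
    (hF : ContDiffAt ℝ ∞ (fun w => F (ofVec w)) v)
    (hl : ∀ c : V, ∃ W : Fin (n + 1) → ℂ,
      HasDerivAt (fun t : ℝ => F (ofVec (v + t • W))) c 0) :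
    Function.Surjective (mfderiv 𝓘(ℝ, Fin n → ℂ) 𝓘(ℝ, V) F (ofVec v)) := by
  intro c
  obtain ⟨W, hW⟩ := hl c
  refine ⟨ofVecDeriv v W, ?_⟩
  have h := mfderiv_comp v ((contMDiffAt_of_comp_ofVec hv hF).mdifferentiableAt (by simp))
    (mdifferentiableAt_ofVec hv)
  have h2 : HasLineDerivAt ℝ (fun w => F (ofVec w)) (fderiv ℝ (fun w => F (ofVec w)) v W) v W :=
    (hF.differentiableAt (by simp)).hasFDerivAt.hasLineDerivAt W
  have h3 : fderiv ℝ (fun w => F (ofVec w)) v W = c := HasDerivAt.unique h2 hW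
  rw [← h3, ← mfderiv_eq_fderiv]
  exact (congrArg (fun A => A W) h).symm

theorem contMDiff_ofVec_comp {g : ℝ → Fin (n + 1) → ℂ} (hg : ContDiff ℝ ∞ g)
    (h0 : ∀ t, g t ≠ 0) :
    ContMDiff 𝓘(ℝ, ℝ) 𝓘(ℝ, Fin n → ℂ) ∞ fun t => ofVec (g t) := fun t =>
  (contMDiffAt_ofVec (h0 t)).comp t hg.contMDiff.contMDiffAt

theorem ofVecDeriv_mem_tangentVectors {S : Set (CP n)} {g : ℝ → Fin (n + 1) → ℂ}
    (hg : ContDiff ℝ ∞ g) (h0 : ∀ t, g t ≠ 0) (hS : ∀ t, ofVec (g t) ∈ S)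
    {v V : Fin (n + 1) → ℂ} (hv : g 0 = v) (hV : HasDerivAt g V 0) :
    ofVecDeriv v V ∈ tangentVectors (Fin n → ℂ) S (ofVec v) := by
  subst hv
  refine ⟨fun t => ofVec (g t), contMDiff_ofVec_comp hg h0, hS, rfl, ?_⟩
  have h := mfderiv_comp (0 : ℝ) (mdifferentiableAt_ofVec (h0 0))
    (hV.differentiableAt.mdifferentiableAt)
  refine (congrArg (fun A => A (1 : ℝ)) h).trans ?_
  have h' : (fderiv ℝ g 0 : ℝ →L[ℝ] (Fin (n + 1) → ℂ)) 1 = V := by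
    rw [hV.hasFDerivAt.fderiv]
    simp
  rw [← h', ← mfderiv_eq_fderiv]
  rfl

end CP

open CP

/-! ### Real coordinates -/

/-- The linear coordinates of `ℂ³` in which `lagrangianL2` is the real projective plane. -/
def realFrame : (Fin 3 → ℂ) ≃ₗ[ℂ] (Fin 3 → ℂ) where
  toFun x := ![x 0 - Complex.I * x 1, (Real.sqrt 2 : ℝ) * Complex.I * x 2,
    x 0 + Complex.I * x 1]
  invFun z := ![(z 0 + z 2) / 2, Complex.I * (z 0 - z 2) / 2,
    -Complex.I * z 1 / (Real.sqrt 2 : ℝ)]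
  map_add' x y := by
    funext i
    fin_cases i <;> simp <;> ring
  map_smul' c x := by
    funext i
    fin_cases i <;> simp <;> ring
  left_inv x := by
    funext i
    fin_cases i
    · simp
    · simp
      linear_combination (-x 1) * Complex.I_sq
    · simp
      field_simp
      linear_combination (-x 2) * Complex.I_sq
  right_inv z := by
    funext i
    fin_cases i
    · simp
      linear_combination (-(z 0 - z 2) / 2) * Complex.I_sq
    · simp
      field_simp
      linear_combination (-z 1) * Complex.I_sq
    · simp
      linear_combination ((z 0 - z 2) / 2) * Complex.I_sq

/-- Real vectors as complex vectors. -/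
def ofRealVec (r : Fin 3 → ℝ) : Fin 3 → ℂ := fun i => (r i : ℂ)

theorem realFrame_ne_zero {x : Fin 3 → ℂ} (hx : x ≠ 0) : realFrame x ≠ 0 :=
  (LinearEquiv.map_ne_zero_iff _).2 hx

theorem ofRealVec_ne_zero {r : Fin 3 → ℝ} (hr : r ≠ 0) : ofRealVec r ≠ 0 := by
  intro h
  apply hr
  funext i
  exact Complex.ofReal_eq_zero.1 (congrFun h i)

theorem realFrame_ofRealVec_ne_zero {r : Fin 3 → ℝ} (hr : r ≠ 0) :
    realFrame (ofRealVec r) ≠ 0 :=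
  realFrame_ne_zero (ofRealVec_ne_zero hr)

theorem exists_ofRealVec_eq {x : Fin 3 → ℂ} (hx : ∀ i, (x i).im = 0) :
    ∃ r, ofRealVec r = x :=
  ⟨fun i => (x i).re, funext fun i => Complex.ext rfl (hx i).symm⟩

/-- The normalization X² + Y² + Z² = 1 can be dropped, since dividing by the norm does not move the
projective point. -/
theorem mem_lagrangianL2_iff {p : CP 2} :
    p ∈ lagrangianL2 ↔ ∃ r : Fin 3 → ℝ, r ≠ 0 ∧ ofVec (realFrame (ofRealVec r)) = p := by
  constructor
  · rintro ⟨X, Y, Z, h, rfl⟩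
    have hr : ![X, Y, Z] ≠ 0 := by
      intro h0
      have h1 := congrFun h0 0
      have h2 := congrFun h0 1
      have h3 := congrFun h0 2
      simp at h1 h2 h3
      simp [h1, h2, h3] at h
    exact ⟨![X, Y, Z], hr, ofVec_of_ne_zero (realFrame_ofRealVec_ne_zero hr)⟩
  · rintro ⟨r, hr, rfl⟩
    have hpos : 0 < r 0 ^ 2 + r 1 ^ 2 + r 2 ^ 2 := by
      obtain ⟨i, hi⟩ := Function.ne_iff.1 hr
      have hi : 0 < r i ^ 2 := sq_pos_of_ne_zero hi
      fin_cases i <;> simp at hi <;> positivity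
    set s := (Real.sqrt (r 0 ^ 2 + r 1 ^ 2 + r 2 ^ 2))⁻¹ with hs
    have hs0 : (s : ℂ) ≠ 0 := by
      rw [Complex.ofReal_ne_zero]
      positivity
    have hs2 : s ^ 2 * (r 0 ^ 2 + r 1 ^ 2 + r 2 ^ 2) = 1 := by
      rw [hs, inv_pow, Real.sq_sqrt hpos.le, inv_mul_cancel₀ hpos.ne']
    refine ⟨s * r 0, s * r 1, s * r 2, by linear_combination hs2, ?_⟩
    rw [← ofVec_smul hs0 (realFrame_ofRealVec_ne_zero hr), ← map_smul,
      ofVec_of_ne_zero (by rw [map_smul]; exact smul_ne_zero hs0 (realFrame_ofRealVec_ne_zero hr))]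
    congr 1
    funext i
    fin_cases i <;> simp [lagrangianVec, realFrame, ofRealVec] <;> ring

/-- The real coordinates normalized by the `k`-th one. -/
def realCoord (k : Fin 3) : CP 2 → Fin 3 → ℂ :=
  CP.lift (fun v => (realFrame.symm v k)⁻¹ • realFrame.symm v) (by
    intro v t _ ht
    simp only [map_smul, Pi.smul_apply, smul_eq_mul, smul_smul]
    congr 1
    field_simp)

theorem realCoord_ofVec (k : Fin 3) {v : Fin 3 → ℂ} (hv : v ≠ 0) :
    realCoord k (ofVec v) = (realFrame.symm v k)⁻¹ • realFrame.symm v :=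
  lift_ofVec _ _ hv

/-- The domain on which the `k`-th real coordinate does not vanish. -/
def realDomain (k : Fin 3) : Set (CP 2) := {p | realCoord k p k ≠ 0}

theorem ofVec_mem_realDomain (k : Fin 3) {v : Fin 3 → ℂ} (hv : v ≠ 0) :
    ofVec v ∈ realDomain k ↔ realFrame.symm v k ≠ 0 := by
  simp [realDomain, realCoord_ofVec k hv]

theorem exists_mem_realDomain (p : CP 2) : ∃ k, p ∈ realDomain k := by
  obtain ⟨v, hv, rfl⟩ := exists_eq_ofVec p
  simp only [ofVec_mem_realDomain _ hv]
  exact Function.ne_iff.1 ((LinearEquiv.map_ne_zero_iff realFrame.symm).2 hv)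

theorem contDiff_realFrame : ContDiff ℝ ∞ realFrame :=
  (realFrame.toLinearMap.restrictScalars ℝ).toContinuousLinearMap.contDiff

theorem contDiff_realFrame_symm : ContDiff ℝ ∞ realFrame.symm :=
  (realFrame.symm.toLinearMap.restrictScalars ℝ).toContinuousLinearMap.contDiff

theorem isOpen_realDomain (k : Fin 3) : IsOpen (realDomain k) := by
  rw [← isQuotientMap_mk.isOpen_preimage]
  have hc : Continuous fun v : {v : Fin 3 → ℂ // v ≠ 0} => realFrame.symm v.1 k :=
    (continuous_apply k).comp (contDiff_realFrame_symm.continuous.comp continuous_subtype_val)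
  convert isOpen_ne.preimage hc using 1
  ext v
  rw [mem_preimage, ← ofVec_of_ne_zero v.2, ofVec_mem_realDomain k v.2]
  rfl

theorem ofVec_realFrame_realCoord {k : Fin 3} {p : CP 2} (hp : p ∈ realDomain k) :
    ofVec (realFrame (realCoord k p)) = p := by
  obtain ⟨v, hv, rfl⟩ := exists_eq_ofVec p
  rw [realCoord_ofVec k hv, map_smul, LinearEquiv.apply_symm_apply, ofVec_smul _ hv]
  exact inv_ne_zero ((ofVec_mem_realDomain k hv).1 hp)

theorem realCoord_self {k : Fin 3} {p : CP 2} (hp : p ∈ realDomain k) : realCoord k p k = 1 := by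
  obtain ⟨v, hv, rfl⟩ := exists_eq_ofVec p
  have := (ofVec_mem_realDomain k hv).1 hp
  simp [realCoord_ofVec k hv, this]

theorem realCoord_ne_zero {k : Fin 3} {p : CP 2} (hp : p ∈ realDomain k) : realCoord k p ≠ 0 :=
  fun h => by simpa [h] using realCoord_self hp

/-- Dividing by the k-th coordinate removes the scalar ambiguity: a point has a real representative
exactly when all these ratios are real. -/
theorem mem_lagrangianL2_iff_im {k : Fin 3} {p : CP 2} (hp : p ∈ realDomain k) :
    p ∈ lagrangianL2 ↔ ∀ i, (realCoord k p i).im = 0 := by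
  rw [mem_lagrangianL2_iff]
  constructor
  · rintro ⟨r, hr, rfl⟩ i
    rw [realCoord_ofVec k (realFrame_ofRealVec_ne_zero hr), LinearEquiv.symm_apply_apply]
    simp only [ofRealVec, Pi.smul_apply, smul_eq_mul]
    rw [← Complex.ofReal_inv, ← Complex.ofReal_mul, Complex.ofReal_im]
  · intro h
    obtain ⟨r, hr⟩ := exists_ofRealVec_eq h
    refine ⟨r, ?_, by rw [hr, ofVec_realFrame_realCoord hp]⟩
    rintro rfl
    exact realCoord_ne_zero hp (hr ▸ funext fun i => Complex.ofReal_zero)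

theorem contDiffAt_realCoord_comp_ofVec {k : Fin 3} {v : Fin 3 → ℂ} (hv : v ≠ 0)
    (hk : ofVec v ∈ realDomain k) : ContDiffAt ℝ ∞ (fun w => realCoord k (ofVec w)) v := by
  rw [ofVec_mem_realDomain k hv] at hk
  have h1 := contDiff_realFrame_symm.contDiffAt (x := v)
  refine ((((contDiffAt_pi.1 h1) k).inv hk).smul h1).congr_of_eventuallyEq ?_
  filter_upwards [eventually_ne_nhds hv] with w hw
  exact realCoord_ofVec k hw

theorem contMDiffAt_realCoord {k : Fin 3} {p : CP 2} (hp : p ∈ realDomain k) :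
    ContMDiffAt 𝓘(ℝ, Fin 2 → ℂ) 𝓘(ℝ, Fin 3 → ℂ) ∞ (realCoord k) p := by
  obtain ⟨v, hv, rfl⟩ := exists_eq_ofVec p
  exact contMDiffAt_of_comp_ofVec hv (contDiffAt_realCoord_comp_ofVec hv hp)

/-! ### The lagrangian submanifold -/

/-- The imaginary parts of the normalized real coordinates. -/
def imCoord (k : Fin 3) (p : CP 2) (i : Fin 2) : ℝ := (realCoord k p (k.succAbove i)).im

theorem contDiff_imCoord (k : Fin 3) :
    ContDiff ℝ ∞ fun (x : Fin 3 → ℂ) (i : Fin 2) => (x (k.succAbove i)).im :=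
  contDiff_pi.2 fun i => Complex.imCLM.contDiff.comp (contDiff_apply ℝ ℂ (k.succAbove i))

theorem surjective_mfderiv_imCoord {k : Fin 3} {p : CP 2} (hp : p ∈ realDomain k) :
    Function.Surjective
      (mfderiv 𝓘(ℝ, Fin 2 → ℂ) 𝓘(ℝ, Fin 2 → ℝ) (imCoord k) p) := by
  obtain ⟨v, hv, rfl⟩ := exists_eq_ofVec p
  refine surjective_mfderiv_of_lines hv
    ((contDiff_imCoord k).contDiffAt.comp v (contDiffAt_realCoord_comp_ofVec hv hp)) ?_
  intro c
  rw [ofVec_mem_realDomain k hv] at hp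
  set x := realFrame.symm v with hx
  -- The k-th coordinate stays fixed, so dividing by it turns the increment t x_k c_i i into t c_i
  -- i: the imaginary part is affine in t with slope c_i.
  refine ⟨realFrame (k.insertNth (α := fun _ => ℂ) 0 fun i => x k * (c i * Complex.I)), ?_⟩
  rw [hasDerivAt_pi]
  intro i
  have hlin : HasDerivAt (fun t : ℝ => ((x k)⁻¹ * x (k.succAbove i)).im + t * c i) (c i) 0 := by
    simpa using ((hasDerivAt_id (0 : ℝ)).mul_const (c i)).const_add
      ((x k)⁻¹ * x (k.succAbove i)).im
  refine hlin.congr_of_eventuallyEq ?_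
  have hne : ∀ᶠ t : ℝ in 𝓝 0, v + t • realFrame (k.insertNth (α := fun _ => ℂ) 0
      fun i => x k * (c i * Complex.I)) ≠ 0 := by
    refine ContinuousAt.eventually_ne ?_ (by simpa using hv)
    fun_prop
  filter_upwards [hne] with t ht
  have hs : ∀ w, realFrame.symm (v + t • realFrame w) = x + t • w := by
    intro w
    rw [map_add, ← hx]
    congr 1
    rw [← Complex.coe_smul, ← map_smul, LinearEquiv.symm_apply_apply, Complex.coe_smul]
  simp only [imCoord]
  rw [realCoord_ofVec k ht, hs]
  simp only [Pi.smul_apply, Pi.add_apply, Fin.insertNth_apply_same, Fin.insertNth_apply_succAbove,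
    smul_zero, add_zero, smul_eq_mul, mul_add, Complex.add_im, Complex.real_smul]
  congr 1
  rw [show (x k)⁻¹ * (t * (x k * (c i * Complex.I))) = ((t * c i : ℝ) : ℂ) * Complex.I by
    push_cast
    field_simp]
  simp

theorem isSmoothSubmanifold_lagrangianL2 : IsSmoothSubmanifold (Fin 2 → ℂ) 2 lagrangianL2 := by
  intro p _
  obtain ⟨k, hk⟩ := exists_mem_realDomain p
  refine ⟨realDomain k, imCoord k, isOpen_realDomain k, hk, fun q hq => ?_,
    fun q hq => surjective_mfderiv_imCoord hq.2, ?_⟩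
  · exact ((contDiff_imCoord k).contMDiff.contMDiffAt.comp q
      (contMDiffAt_realCoord hq)).contMDiffWithinAt
  · ext q
    rw [mem_inter_iff, mem_ofPred_eq, and_comm]
    refine and_congr_right fun hq => ?_
    rw [mem_lagrangianL2_iff_im hq]
    refine ⟨fun h => funext fun i => h _, fun h i => ?_⟩
    refine Fin.succAboveCases k ?_ (fun i => ?_) i
    · rw [realCoord_self hq, Complex.one_im]
    · exact congrFun h i

theorem isCompact_lagrangianL2 : IsCompact lagrangianL2 := by
  have h : lagrangianL2 = (fun r : EuclideanSpace ℝ (Fin 3) =>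
      ofVec (realFrame (ofRealVec r))) '' Metric.sphere 0 1 := by
    ext p
    constructor
    · rintro ⟨X, Y, Z, h, rfl⟩
      refine ⟨!₂[X, Y, Z], ?_, ofVec_of_ne_zero (lagrangianVec_ne_zero h)⟩
      rw [mem_sphere_zero_iff_norm, EuclideanSpace.norm_eq]
      simp [Fin.sum_univ_three, h]
    · rintro ⟨r, hr, rfl⟩
      refine mem_lagrangianL2_iff.2 ⟨r, fun h => ?_, rfl⟩
      rw [mem_sphere_zero_iff_norm, EuclideanSpace.norm_eq] at hr
      simp [h] at hr
  rw [h]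
  refine (isCompact_sphere _ _).image_of_continuousOn fun r hr => ContinuousAt.continuousWithinAt ?_
  have hr0 : (r : Fin 3 → ℝ) ≠ 0 := by
    intro h
    rw [mem_sphere_zero_iff_norm, EuclideanSpace.norm_eq] at hr
    simp [h] at hr
  have hc : Continuous fun r : EuclideanSpace ℝ (Fin 3) => realFrame (ofRealVec r) :=
    contDiff_realFrame.continuous.comp (continuous_pi fun i =>
      Complex.continuous_ofReal.comp (EuclideanSpace.proj (𝕜 := ℝ) i).continuous)
  exact ContinuousAt.comp (f := fun r : EuclideanSpace ℝ (Fin 3) => realFrame (ofRealVec r))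
    (continuousAt_ofVec (realFrame_ofRealVec_ne_zero hr0)) hc.continuousAt

/-- Along a curve in the surface the normalized coordinates stay real, hence so does their
derivative; `ofVec` ∘ `realFrame` recovers the curve from them near 0. -/
theorem exists_real_of_mem_tangentVectors {p : CP 2} {k : Fin 3} (hp : p ∈ realDomain k)
    {u : TangentSpace 𝓘(ℝ, Fin 2 → ℂ) p}
    (hu : u ∈ tangentVectors (Fin 2 → ℂ) lagrangianL2 p) :
    ∃ a : Fin 3 → ℝ, ofVecDeriv (realFrame (realCoord k p)) (realFrame (ofRealVec a)) = u := by
  obtain ⟨γ, hγ, hL, rfl, rfl⟩ := hu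
  have hγ0 : MDifferentiableAt 𝓘(ℝ, ℝ) 𝓘(ℝ, Fin 2 → ℂ) γ 0 :=
    (hγ 0).mdifferentiableAt (by simp)
  have hc : HasDerivAt (fun t => realCoord k (γ t)) (deriv (fun t => realCoord k (γ t)) 0) 0 := by
    have h := (contMDiffAt_realCoord hp).comp 0 (hγ 0)
    exact (h.contDiffAt.differentiableAt (by simp)).hasDerivAt
  have hev : ∀ᶠ t in 𝓝 (0 : ℝ), γ t ∈ realDomain k :=
    hγ.continuous.continuousAt.eventually ((isOpen_realDomain k).mem_nhds hp)
  obtain ⟨a, ha⟩ : ∃ a, ofRealVec a = deriv (fun t => realCoord k (γ t)) 0 := by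
    refine exists_ofRealVec_eq fun i => ?_
    have h1 := Complex.imCLM.hasFDerivAt.comp_hasDerivAt (0 : ℝ) (hasDerivAt_pi.1 hc i)
    refine h1.unique ((hasDerivAt_const (0 : ℝ) (0 : ℝ)).congr_of_eventuallyEq ?_)
    filter_upwards [hev] with t ht
    exact (mem_lagrangianL2_iff_im ht).1 (hL t) i
  refine ⟨a, ?_⟩
  have hg : HasDerivAt (fun t => realFrame (realCoord k (γ t))) (realFrame (ofRealVec a)) 0 := by
    rw [ha]
    exact (realFrame.toLinearMap.restrictScalars ℝ).toContinuousLinearMap.hasFDerivAt.comp_hasDerivAt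
      (0 : ℝ) hc
  have hne := realFrame_ne_zero (realCoord_ne_zero hp)
  have h := mfderiv_comp (0 : ℝ) (mdifferentiableAt_ofVec hne)
    hg.differentiableAt.mdifferentiableAt
  have heq : ofVec ∘ (fun t => realFrame (realCoord k (γ t))) =ᶠ[𝓝 0] γ := by
    filter_upwards [hev] with t ht
    exact ofVec_realFrame_realCoord ht
  rw [heq.mfderiv_eq] at h
  have h' : (fderiv ℝ (fun t => realFrame (realCoord k (γ t))) 0 : ℝ →L[ℝ] (Fin 3 → ℂ)) 1 =
      realFrame (ofRealVec a) := by
    rw [hg.hasFDerivAt.fderiv]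
    simp
  rw [← h', ← mfderiv_eq_fderiv]
  exact (congrArg (fun A => A (1 : ℝ)) h).symm

theorem star_realFrame_dotProduct (a b : Fin 3 → ℝ) :
    star (realFrame (ofRealVec a)) ⬝ᵥ realFrame (ofRealVec b) =
      ((2 * (a 0 * b 0 + a 1 * b 1 + a 2 * b 2) : ℝ) : ℂ) := by
  have h2 : ((Real.sqrt 2 : ℝ) : ℂ) ^ 2 = 2 := by
    rw [← Complex.ofReal_pow, Real.sq_sqrt (by norm_num)]
    simp
  simp [dotProduct, Fin.sum_univ_three, realFrame, ofRealVec]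
  linear_combination (-2 * (a 1 : ℂ) * b 1 - ((Real.sqrt 2 : ℝ) : ℂ) ^ 2 * a 2 * b 2) *
    Complex.I_sq + (a 2 : ℂ) * b 2 * h2

/-- All Hermitian products involved are real, so the imaginary part is zero. -/
theorem homogeneousForm_realFrame (r a b : Fin 3 → ℝ) :
    homogeneousForm (realFrame (ofRealVec r)) (realFrame (ofRealVec a))
      (realFrame (ofRealVec b)) = 0 := by
  have h : ∀ z V W : Fin 3 → ℂ, homogeneousForm z V W =
    ((star V ⬝ᵥ W) / (star z ⬝ᵥ z) - (star V ⬝ᵥ z) * (star z ⬝ᵥ W) / (star z ⬝ᵥ z) ^ 2).im :=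
    fun _ _ _ => rfl
  simp only [h, star_realFrame_dotProduct]
  rw [← Complex.ofReal_mul, ← Complex.ofReal_pow, ← Complex.ofReal_div, ← Complex.ofReal_div,
    ← Complex.ofReal_sub, Complex.ofReal_im]

theorem finrank_real_pi_complex : Module.finrank ℝ (Fin 2 → ℂ) = 2 * 2 := by
  rw [Module.finrank_pi_fintype]
  simp

theorem isLagrangian_lagrangianL2 : IsLagrangian (fubiniStudy 2) lagrangianL2 := by
  refine ⟨⟨2, finrank_real_pi_complex, isSmoothSubmanifold_lagrangianL2⟩, ?_⟩
  intro p hp u hu v hv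
  obtain ⟨k, hk⟩ := exists_mem_realDomain p
  obtain ⟨a, rfl⟩ := exists_real_of_mem_tangentVectors hk hu
  obtain ⟨b, rfl⟩ := exists_real_of_mem_tangentVectors hk hv
  obtain ⟨r, hr⟩ := exists_ofRealVec_eq ((mem_lagrangianL2_iff_im hk).1 hp)
  have h := fubiniStudy_ofVecDeriv (realFrame_ne_zero (realCoord_ne_zero hk))
    (realFrame (ofRealVec a)) (realFrame (ofRealVec b))
  rw [ofVec_realFrame_realCoord hk] at h
  rw [h, ← hr, homogeneousForm_realFrame]

/-! ### The level set -/

theorem moment_ofVec (j : Fin 3) {v : Fin 3 → ℂ} (hv : v ≠ 0) :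
    moment j (ofVec v) =
      -(1 / 2) * (‖v j‖ ^ 2 / (‖v 0‖ ^ 2 + ‖v 1‖ ^ 2 + ‖v 2‖ ^ 2)) := by
  rw [moment, lift_ofVec _ _ hv]
  congr 2
  exact Fin.sum_univ_three _

theorem ofVec_mem_level_iff {v : Fin 3 → ℂ} (hv : v ≠ 0) :
    ofVec v ∈ mu2 ⁻¹' {-1 / 6} ↔ ‖v 0‖ ^ 2 + ‖v 1‖ ^ 2 = 2 * ‖v 2‖ ^ 2 := by
  rw [ofVec_of_ne_zero hv, level_iff]

theorem sum_norm_sq_pos {v : Fin 3 → ℂ} (hv : v ≠ 0) :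
    0 < ‖v 0‖ ^ 2 + ‖v 1‖ ^ 2 + ‖v 2‖ ^ 2 := by
  obtain ⟨i, hi⟩ := Function.ne_iff.1 hv
  have hi : 0 < ‖v i‖ ^ 2 := pow_pos (norm_pos_iff.2 hi) 2
  fin_cases i <;> simp at hi <;> positivity

theorem level_last_ne_zero {v : Fin 3 → ℂ} (hv : v ≠ 0)
    (h : ‖v 0‖ ^ 2 + ‖v 1‖ ^ 2 = 2 * ‖v 2‖ ^ 2) : v 2 ≠ 0 := by
  intro h2
  have := sum_norm_sq_pos hv
  rw [h, h2] at this
  simp at this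

theorem contDiffAt_moment_comp_ofVec (j : Fin 3) {v : Fin 3 → ℂ} (hv : v ≠ 0) :
    ContDiffAt ℝ ∞ (fun w => moment j (ofVec w)) v := by
  have h : ∀ k : Fin 3, ContDiffAt ℝ ∞ (fun w : Fin 3 → ℂ => ‖w k‖ ^ 2) v := fun k =>
    ((contDiff_apply ℝ ℂ k).norm_sq ℝ).contDiffAt
  have h' : ContDiffAt ℝ ∞ (fun w : Fin 3 → ℂ =>
      -(1 / 2) * (‖w j‖ ^ 2 / (‖w 0‖ ^ 2 + ‖w 1‖ ^ 2 + ‖w 2‖ ^ 2))) v :=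
    contDiffAt_const.mul ((h j).div (((h 0).add (h 1)).add (h 2)) (sum_norm_sq_pos hv).ne')
  refine h'.congr_of_eventuallyEq ?_
  filter_upwards [eventually_ne_nhds hv] with w hw
  exact moment_ofVec j hw

theorem isSmoothSubmanifold_level :
    IsSmoothSubmanifold (Fin 2 → ℂ) 1 (mu2 ⁻¹' {-1 / 6}) := by
  have hF : ∀ {v : Fin 3 → ℂ}, v ≠ 0 →
      ContDiffAt ℝ ∞ (fun w => fun _ : Fin 1 => mu2 (ofVec w) + 1 / 6) v := fun hv =>
    contDiffAt_pi.2 fun _ => (contDiffAt_moment_comp_ofVec 2 hv).add contDiffAt_const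
  intro p _
  refine ⟨univ, fun p _ => mu2 p + 1 / 6, isOpen_univ, mem_univ p, fun q _ => ?_, fun q hq => ?_,
    ?_⟩
  · obtain ⟨v, hv, rfl⟩ := exists_eq_ofVec q
    exact (contMDiffAt_of_comp_ofVec hv (hF hv)).contMDiffWithinAt
  · obtain ⟨v, hv, rfl⟩ := exists_eq_ofVec q
    refine surjective_mfderiv_of_lines hv (hF hv) fun c => ?_
    have hl := (ofVec_mem_level_iff hv).1 hq.1
    have h2 := level_last_ne_zero hv hl
    have hn : ‖v 2‖ ^ 2 ≠ 0 := by simpa using h2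
    -- Multiplying z₂ by 1 + ts on the level set gives μ₂ = -(1/2)(1 + ts)² / (2 + (1 + ts)²), with
    -- derivative -(2/9)s at t = 0; hence s = -(9/2)c.
    refine ⟨![0, 0, ((-(9 / 2) * c 0 : ℝ) : ℂ) * v 2], ?_⟩
    rw [hasDerivAt_pi]
    intro i
    rw [Subsingleton.elim i 0]
    have h1 : HasDerivAt (fun t : ℝ => (1 + t * (-(9 / 2) * c 0)) ^ 2) (-9 * c 0) 0 := by
      have := (((hasDerivAt_id (0 : ℝ)).mul_const (-(9 / 2) * c 0)).const_add 1).fun_pow 2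
      refine this.congr_deriv ?_
      simp
      ring
    have h3 := (((h1.fun_div (h1.const_add 2) (by norm_num)).const_mul (-(1 / 2))).add_const
      (1 / 6 : ℝ)).congr_deriv (g' := c 0) (by norm_num; ring)
    refine h3.congr_of_eventuallyEq ?_
    have hne : ∀ᶠ t : ℝ in 𝓝 0, v + t • ![0, 0, ((-(9 / 2) * c 0 : ℝ) : ℂ) * v 2] ≠ 0 := by
      refine ContinuousAt.eventually_ne ?_ (by simpa using hv)
      fun_prop
    filter_upwards [hne] with t ht
    have hn2 : ‖(v + t • ![0, 0, ((-(9 / 2) * c 0 : ℝ) : ℂ) * v 2]) 2‖ ^ 2 =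
        (1 + t * (-(9 / 2) * c 0)) ^ 2 * ‖v 2‖ ^ 2 := by
      rw [show (v + t • ![0, 0, ((-(9 / 2) * c 0 : ℝ) : ℂ) * v 2]) 2 =
        ((1 + t * (-(9 / 2) * c 0) : ℝ) : ℂ) * v 2 by simp; ring, norm_mul, mul_pow,
        Complex.norm_real, Real.norm_eq_abs, sq_abs]
    rw [mu2, moment_ofVec 2 ht, hn2]
    simp only [Pi.add_apply, Pi.smul_apply, Matrix.cons_val_zero, Matrix.cons_val_one, smul_zero,
      add_zero, hl]
    rw [← add_mul, mul_div_mul_right _ _ hn]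
  · ext q
    simp only [inter_univ, mem_preimage, mem_singleton_iff, mem_univ, true_and, mem_ofPred_eq,
      funext_iff, Pi.zero_apply, forall_const]
    constructor <;> intro h <;> linarith

theorem norm_add_smul_sq (z V : ℂ) (t : ℝ) :
    ‖z + t * V‖ ^ 2 = ‖z‖ ^ 2 + 2 * t * (star z * V).re + t ^ 2 * ‖V‖ ^ 2 := by
  simp only [Complex.sq_norm, Complex.normSq_apply]
  simp
  ring

/-- The condition `hV` is the linearization of |z₀|² + |z₁|² = 2|z₂|²; the proof integrates such a V
to an explicit curve in the level set. -/
theorem ofVecDeriv_mem_tangentVectors_level {z V : Fin 3 → ℂ} (hz : z ≠ 0)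
    (hl : ofVec z ∈ mu2 ⁻¹' {-1 / 6})
    (hV : (star (z 0) * V 0 + star (z 1) * V 1 - 2 * (star (z 2) * V 2)).re = 0) :
    ofVecDeriv z V ∈ tangentVectors (Fin 2 → ℂ) (mu2 ⁻¹' {-1 / 6}) (ofVec z) := by
  have hl' := (ofVec_mem_level_iff hz).1 hl
  have h2 := level_last_ne_zero hz hl'
  have hN : 0 < ‖z 0‖ ^ 2 + ‖z 1‖ ^ 2 := by
    rw [hl']
    positivity
  -- Subtracting c z kills the last entry without changing the tangent vector; it also preserves
  -- `hV`, since z lies on the level set.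
  set c := V 2 / z 2 with hc
  have hstar : ∀ w : ℂ, star w * w = ((‖w‖ ^ 2 : ℝ) : ℂ) := fun w => by
    rw [Complex.ofReal_pow]
    exact Complex.conj_mul' w
  obtain ⟨W0, hW0⟩ : ∃ W0, W0 = V 0 - c * z 0 := ⟨_, rfl⟩
  obtain ⟨W1, hW1⟩ : ∃ W1, W1 = V 1 - c * z 1 := ⟨_, rfl⟩
  have hV2 : V 2 = c * z 2 := by
    rw [hc]
    field_simp
  have hW : (star (z 0) * W0).re + (star (z 1) * W1).re = 0 := by
    rw [← Complex.add_re, ← hV, hW0, hW1, hV2]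
    congr 1
    have h := congrArg (fun x : ℝ => (x : ℂ)) hl'
    push_cast at h
    have e0 := hstar (z 0)
    have e1 := hstar (z 1)
    have e2 := hstar (z 2)
    push_cast at e0 e1 e2
    linear_combination (-c) * e0 - c * e1 + 2 * c * e2 - c * h
  have hdecomp : V = c • z + ![W0, W1, 0] := by
    funext i
    fin_cases i <;> simp [hW0, hW1, hV2]
  rw [hdecomp, map_add, ofVecDeriv_smul_self hz, zero_add]
  -- The first two entries move linearly, which by `hW` changes |z₀|² + |z₁|² only at order t², by
  -- the factor 1 + t²m. Scaling z₂ by the root of this factor keeps the curve on the level set and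
  -- has zero velocity at 0.
  set m := (‖W0‖ ^ 2 + ‖W1‖ ^ 2) / (‖z 0‖ ^ 2 + ‖z 1‖ ^ 2) with hm
  have hm0 : 0 ≤ m := by positivity
  have hpos : ∀ t : ℝ, 0 < 1 + t ^ 2 * m := fun t => by positivity
  set g : ℝ → Fin 3 → ℂ := fun t =>
    ![z 0 + t * W0, z 1 + t * W1, (Real.sqrt (1 + t ^ 2 * m) : ℝ) * z 2] with hg
  have hg0 : ∀ t, g t ≠ 0 := by
    intro t h
    have h' : ((Real.sqrt (1 + t ^ 2 * m) : ℝ) : ℂ) * z 2 = 0 := congrFun h 2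
    have hs := (Real.sqrt_pos.2 (hpos t)).ne'
    rcases mul_eq_zero.1 h' with h' | h'
    · exact hs (Complex.ofReal_eq_zero.1 h')
    · exact h2 h'
  have hid : ContDiff ℝ ∞ fun t : ℝ => (t : ℂ) := Complex.ofRealCLM.contDiff
  have hsq : ContDiff ℝ ∞ fun t : ℝ => Real.sqrt (1 + t ^ 2 * m) := by
    refine ContDiff.sqrt ?_ fun t => (hpos t).ne'
    fun_prop
  refine ofVecDeriv_mem_tangentVectors (g := g) ?_ hg0 (fun t => ?_) ?_ ?_
  · rw [contDiff_pi]
    intro i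
    fin_cases i
    · exact contDiff_const.add (hid.mul contDiff_const)
    · exact contDiff_const.add (hid.mul contDiff_const)
    · exact (Complex.ofRealCLM.contDiff.comp hsq).mul contDiff_const
  · rw [ofVec_mem_level_iff (hg0 t)]
    change ‖z 0 + t * W0‖ ^ 2 + ‖z 1 + t * W1‖ ^ 2 =
      2 * ‖((Real.sqrt (1 + t ^ 2 * m) : ℝ) : ℂ) * z 2‖ ^ 2
    rw [norm_add_smul_sq, norm_add_smul_sq, norm_mul, mul_pow, Complex.norm_real,
      Real.norm_eq_abs, sq_abs, Real.sq_sqrt (hpos t).le]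
    have hm' : m * (‖z 0‖ ^ 2 + ‖z 1‖ ^ 2) = ‖W0‖ ^ 2 + ‖W1‖ ^ 2 := by
      rw [hm]
      field_simp
    linear_combination (1 + t ^ 2 * m) * hl' + 2 * t * hW - t ^ 2 * hm'
  · funext i
    fin_cases i <;> simp [hg]
  · rw [hasDerivAt_pi]
    have hd : HasDerivAt (fun t : ℝ => (t : ℂ)) 1 0 := Complex.ofRealCLM.hasDerivAt
    intro i
    fin_cases i
    · simpa [hg] using (hd.mul_const W0).const_add (z 0)
    · simpa [hg] using (hd.mul_const W1).const_add (z 1)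
    · have h1 : HasDerivAt (fun t : ℝ => 1 + t ^ 2 * m) 0 0 := by
        simpa using ((hasDerivAt_pow 2 (0 : ℝ)).mul_const m).const_add 1
      have h3 := ((h1.sqrt (hpos 0).ne').ofReal_comp).mul_const (z 2)
      simpa [hg] using h3

/-! ### The lifting -/

theorem level_iff_realFrame {r : Fin 3 → ℝ} (hr : r ≠ 0) :
    ofVec (realFrame (ofRealVec r)) ∈ mu2 ⁻¹' {-1 / 6} ↔
      2 * r 2 ^ 2 = r 0 ^ 2 + r 1 ^ 2 := by
  rw [ofVec_mem_level_iff (realFrame_ofRealVec_ne_zero hr)]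
  have h0 : ‖realFrame (ofRealVec r) 0‖ ^ 2 = r 0 ^ 2 + r 1 ^ 2 := by
    simp only [Complex.sq_norm, Complex.normSq_apply]
    simp [realFrame, ofRealVec]
    ring
  have h1 : ‖realFrame (ofRealVec r) 1‖ ^ 2 = 2 * r 2 ^ 2 := by
    simp [realFrame, ofRealVec, mul_pow]
  have h2 : ‖realFrame (ofRealVec r) 2‖ ^ 2 = r 0 ^ 2 + r 1 ^ 2 := by
    simp only [Complex.sq_norm, Complex.normSq_apply]
    simp [realFrame, ofRealVec]
    ring
  rw [h0, h1, h2]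
  constructor <;> intro h <;> linarith

theorem intersectTransversally_lagrangianL2 :
    IntersectTransversally (Fin 2 → ℂ) 2 1 lagrangianL2 (mu2 ⁻¹' {-1 / 6}) := by
  refine ⟨isSmoothSubmanifold_lagrangianL2, isSmoothSubmanifold_level, ?_⟩
  rintro p ⟨hpL, hpl⟩
  obtain ⟨r, hr, rfl⟩ := mem_lagrangianL2_iff.1 hpL
  have hz := realFrame_ofRealVec_ne_zero hr
  have hl := (level_iff_realFrame hr).1 hpl
  have hr2 : r 2 ≠ 0 := by
    intro h2
    apply hr
    rw [h2] at hl
    have h0 : r 0 = 0 := by nlinarith [sq_nonneg (r 0), sq_nonneg (r 1)]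
    have h1 : r 1 = 0 := by nlinarith [sq_nonneg (r 0), sq_nonneg (r 1)]
    funext i
    fin_cases i <;> assumption
  set z := realFrame (ofRealVec r) with hzdef
  intro v
  obtain ⟨V, hVv⟩ := ofVecDeriv_surjective hz v
  set c := (star (z 0) * V 0 + star (z 1) * V 1 - 2 * (star (z 2) * V 2)).re with hc
  -- Here c measures the failure of V to be tangent to the level set. The move U of Z alone gives
  -- conj(z₁) U₁ = 2 r₂² d, so this d makes V - U tangent.
  set d := c / (2 * r 2 ^ 2) with hd
  set U : Fin 3 → ℂ := realFrame (ofRealVec ![0, 0, d * r 2]) with hU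
  refine ⟨ofVecDeriv z U, ?_, ofVecDeriv z (V - U), ?_, ?_⟩
  · have hne : ∀ t : ℝ, ![r 0, r 1, r 2 + t * (d * r 2)] ≠ 0 := by
      intro t h
      have h0 : r 0 = 0 := congrFun h 0
      have h1 : r 1 = 0 := congrFun h 1
      rw [h0, h1] at hl
      exact hr2 (by simpa using hl)
    have hder : HasDerivAt (fun t : ℝ => ofRealVec ![r 0, r 1, r 2 + t * (d * r 2)])
        (ofRealVec ![0, 0, d * r 2]) 0 := by
      rw [hasDerivAt_pi]
      intro i
      fin_cases i
      · simpa [ofRealVec] using hasDerivAt_const (0 : ℝ) (r 0 : ℂ)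
      · simpa [ofRealVec] using hasDerivAt_const (0 : ℝ) (r 1 : ℂ)
      · have h := (((hasDerivAt_id (0 : ℝ)).mul_const (d * r 2)).const_add (r 2)).ofReal_comp
        simpa [ofRealVec] using h
    have hcd : ContDiff ℝ ∞ (fun t : ℝ => ofRealVec ![r 0, r 1, r 2 + t * (d * r 2)]) := by
      rw [contDiff_pi]
      intro i
      refine Complex.ofRealCLM.contDiff.comp ?_
      fin_cases i
      · exact contDiff_const (c := r 0)
      · exact contDiff_const (c := r 1)
      · exact contDiff_const.add (contDiff_id.mul contDiff_const)
    refine ofVecDeriv_mem_tangentVectors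
      (g := fun t => realFrame (ofRealVec ![r 0, r 1, r 2 + t * (d * r 2)]))
      (contDiff_realFrame.comp hcd) (fun t => realFrame_ofRealVec_ne_zero (hne t))
      (fun t => mem_lagrangianL2_iff.2 ⟨_, hne t, rfl⟩) ?_
      ((realFrame.toLinearMap.restrictScalars ℝ).toContinuousLinearMap.hasFDerivAt.comp_hasDerivAt
        (0 : ℝ) hder)
    congr 2
    funext i
    fin_cases i <;> simp
  · refine ofVecDeriv_mem_tangentVectors_level hz hpl ?_
    have hU0 : U 0 = 0 := by simp [hU, realFrame, ofRealVec]
    have hU2 : U 2 = 0 := by simp [hU, realFrame, ofRealVec]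
    have hU1 : star (z 1) * U 1 = (c : ℂ) := by
      have h2 : ((Real.sqrt 2 : ℝ) : ℂ) ^ 2 = 2 := by
        rw [← Complex.ofReal_pow, Real.sq_sqrt (by norm_num)]
        simp
      have hc' : (c : ℂ) = d * (2 * r 2 ^ 2) := by
        rw [hd]
        push_cast
        have : (r 2 : ℂ) ≠ 0 := Complex.ofReal_ne_zero.2 hr2
        field_simp
      rw [hc']
      simp [hU, hzdef, realFrame, ofRealVec]
      linear_combination (-((Real.sqrt 2 : ℝ) : ℂ) ^ 2 * (r 2 : ℂ) ^ 2 * d) * Complex.I_sq +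
        (r 2 : ℂ) ^ 2 * d * h2
    have e : star (z 0) * (V - U) 0 + star (z 1) * (V - U) 1 - 2 * (star (z 2) * (V - U) 2) =
        (star (z 0) * V 0 + star (z 1) * V 1 - 2 * (star (z 2) * V 2)) - (c : ℂ) := by
      simp only [Pi.sub_apply, hU0, hU2, mul_sub, hU1]
      ring
    rw [e, Complex.sub_re, Complex.ofReal_re, ← hc, sub_self]
  · exact (map_add (ofVecDeriv z) U (V - U)).symm.trans (by rw [add_sub_cancel, hVv])

/-- Both relations hold for real representatives, and a scalar t multiplies their terms by |t| and
|t|² respectively. -/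
theorem conj_relation_of_mem_lagrangianL2 {v : Fin 3 → ℂ} (hv : v ≠ 0)
    (h : ofVec v ∈ lagrangianL2) : ‖v 0‖ = ‖v 2‖ ∧ v 0 * star (v 1) + v 1 * star (v 2) = 0 := by
  obtain ⟨r, hr, h⟩ := mem_lagrangianL2_iff.1 h
  have hz := realFrame_ofRealVec_ne_zero hr
  rw [ofVec_of_ne_zero hv, ofVec_of_ne_zero hz, Eq.comm, mk_eq_mk_iff] at h
  obtain ⟨t, rfl⟩ := h
  constructor
  · simp only [Pi.smul_apply, smul_eq_mul, norm_mul]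
    congr 1
    rw [← Complex.norm_conj]
    congr 1
    simp [realFrame, ofRealVec]
  · simp [realFrame, ofRealVec]
    ring

theorem mem_lagrangianL2_of_conj_relation {v : Fin 3 → ℂ} (h0 : v 0 ≠ 0) (h1 : v 1 ≠ 0)
    (h : v 0 * star (v 1) + v 1 * star (v 2) = 0) : ofVec v ∈ lagrangianL2 := by
  have hv : v ≠ 0 := fun hv => h0 (congrFun hv 0)
  -- This multiplier makes the middle coordinate i|v₁|², purely imaginary; the relation `h` then
  -- says that the outer two coordinates are conjugate.
  set t : ℂ := star (v 1) * Complex.I with ht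
  have ht0 : t ≠ 0 := mul_ne_zero (star_ne_zero.2 h1) Complex.I_ne_zero
  have hk : ∀ i, (realFrame.symm (t • v) i).im = 0 := by
    have hc : (starRingEnd ℂ) (v 0) * v 1 + (starRingEnd ℂ) (v 1) * v 2 = 0 := by
      simpa using congrArg star h
    have hc2 : (starRingEnd ℂ) 2 = 2 := Complex.conj_ofNat 2
    have h' : v 0 * (starRingEnd ℂ) (v 1) + v 1 * (starRingEnd ℂ) (v 2) = 0 := h
    intro i
    rw [← Complex.conj_eq_iff_im]
    fin_cases i
    · simp [realFrame, ht, hc2]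
      linear_combination (-Complex.I / 2) * (hc + h')
    · simp [realFrame, ht, hc2]
      linear_combination (Complex.I ^ 2 / 2) * (hc - h')
    · simp [realFrame, ht]
      ring
  obtain ⟨r, hr⟩ := exists_ofRealVec_eq hk
  refine mem_lagrangianL2_iff.2 ⟨r, ?_, ?_⟩
  · rintro rfl
    have h0' : realFrame.symm (t • v) = 0 := hr ▸ funext fun i => Complex.ofReal_zero
    rw [LinearEquiv.map_eq_zero_iff] at h0'
    exact smul_ne_zero ht0 hv h0'
  · rw [hr, LinearEquiv.apply_symm_apply, ofVec_smul ht0 hv]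

/-! ### Orbits in the level set and the reduced moment map -/

theorem smul_ofVec (g : Circle) {v : Fin 3 → ℂ} (hv : v ≠ 0) :
    g • ofVec v = ofVec (rotateLinear g v) := by
  rw [ofVec_of_ne_zero hv, smul_mk, ofVec_of_ne_zero (rotateLinear_ne_zero g hv)]

theorem muRed_mk (x : mu2 ⁻¹' {(-1 / 6 : ℝ)}) :
    muRed (orbitProj Circle mu2 (-1 / 6) x) = moment 1 (x : CP 2) := rfl

theorem exists_orbitProj_eq (y : Reduced) : ∃ x, orbitProj Circle mu2 (-1 / 6) x = y :=
  Quotient.exists_rep y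

/-- On the level set |z|² = (3/2)(|z₀|² + |z₁|²), which turns the factor 1/2 into 1/3. -/
theorem moment_one_of_level {v : Fin 3 → ℂ} (hv : v ≠ 0)
    (hl : ‖v 0‖ ^ 2 + ‖v 1‖ ^ 2 = 2 * ‖v 2‖ ^ 2) :
    moment 1 (ofVec v) = -(1 / 3) * (‖v 1‖ ^ 2 / (‖v 0‖ ^ 2 + ‖v 1‖ ^ 2)) := by
  have h2 : ‖v 2‖ ^ 2 ≠ 0 := by simpa using level_last_ne_zero hv hl
  rw [moment_ofVec 1 hv, hl]
  field_simp
  norm_num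

theorem moment_one_eq_middle_iff {v : Fin 3 → ℂ} (hv : v ≠ 0)
    (hl : ‖v 0‖ ^ 2 + ‖v 1‖ ^ 2 = 2 * ‖v 2‖ ^ 2) :
    moment 1 (ofVec v) = -1 / 6 ↔ ‖v 0‖ ^ 2 = ‖v 1‖ ^ 2 := by
  have h2 : ‖v 2‖ ^ 2 ≠ 0 := by simpa using level_last_ne_zero hv hl
  have hN : ‖v 0‖ ^ 2 + ‖v 1‖ ^ 2 ≠ 0 := by simpa [hl] using h2
  rw [moment_one_of_level hv hl]
  field_simp
  constructor <;> intro h <;> linarith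

theorem injOn_orbitProj_lagrangianL2 :
    InjOn (orbitProj Circle mu2 (-1 / 6)) {x | (x : CP 2) ∈ lagrangianL2} := by
  rintro ⟨p, hp⟩ hpL ⟨q, hq⟩ hqL h
  obtain ⟨g, hg⟩ := Quotient.exact h
  change g • q = p at hg
  rw [Subtype.mk.injEq, ← hg]
  obtain ⟨v, hv, rfl⟩ := exists_eq_ofVec q
  have hl := (ofVec_mem_level_iff hv).1 hq
  have h2 := level_last_ne_zero hv hl
  obtain ⟨hn, hr⟩ := conj_relation_of_mem_lagrangianL2 hv hqL
  change p ∈ lagrangianL2 at hpL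
  rw [← hg, smul_ofVec g hv] at hpL
  have hr' := (conj_relation_of_mem_lagrangianL2 (rotateLinear_ne_zero g hv) hpL).2
  have h1 : v 1 ≠ 0 := by
    intro h1
    rw [hn, h1] at hl
    have : ‖v 2‖ ^ 2 = 0 := by
      simp only [norm_zero] at hl
      linarith
    exact h2 (by simpa using this)
  have hr'' : v 0 * star (v 1) + v 1 * star (g * v 2) = 0 := hr'
  -- The relation holds with both v₂ and g v₂ beside the same v₀ and v₁; subtracting and cancelling
  -- v₁ ≠ 0 identifies them.
  have hs : star ((g : ℂ) * v 2) = star (v 2) :=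
    mul_left_cancel₀ h1 (by linear_combination hr'' - hr)
  have hg1 : (g : ℂ) = 1 := by
    have := star_injective hs
    exact mul_right_cancel₀ h2 (by rw [this, one_mul])
  have : g = 1 := Circle.ext hg1
  rw [this, one_smul]

theorem image_lagrangianL2_eq :
    orbitProj Circle mu2 (-1 / 6) '' {x | (x : CP 2) ∈ lagrangianL2} = muRed ⁻¹' {-1 / 6} := by
  ext y
  constructor
  · rintro ⟨⟨p, hp⟩, hpL, rfl⟩
    obtain ⟨v, hv, rfl⟩ := exists_eq_ofVec p
    have hl := (ofVec_mem_level_iff hv).1 hp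
    have hn := (conj_relation_of_mem_lagrangianL2 hv hpL).1
    change moment 1 (ofVec v) = -1 / 6
    rw [moment_one_eq_middle_iff hv hl]
    rw [← hn] at hl
    linarith
  · obtain ⟨⟨p, hp⟩, rfl⟩ := exists_orbitProj_eq y
    intro hy
    obtain ⟨v, hv, rfl⟩ := exists_eq_ofVec p
    have hl := (ofVec_mem_level_iff hv).1 hp
    have h01 : ‖v 0‖ ^ 2 = ‖v 1‖ ^ 2 := (moment_one_eq_middle_iff hv hl).1 hy
    have h2 := level_last_ne_zero hv hl
    have h12 : ‖v 1‖ = ‖v 2‖ := by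
      rw [← sq_eq_sq₀ (norm_nonneg _) (norm_nonneg _)]
      linarith
    have h01' : ‖v 0‖ = ‖v 1‖ := by
      rwa [← sq_eq_sq₀ (norm_nonneg _) (norm_nonneg _)]
    have h1 : v 1 ≠ 0 := norm_ne_zero_iff.1 (h12 ▸ norm_ne_zero_iff.2 h2)
    have h0 : v 0 ≠ 0 := norm_ne_zero_iff.1 (h01' ▸ norm_ne_zero_iff.2 h1)
    -- The last entry solves the conjugation relation for z₂. Since |v₀| = |v₁| = |v₂| it has
    -- modulus |v₂|, so w stays on the level set and in the orbit of v.
    set w : Fin 3 → ℂ := ![v 0, v 1, -(star (v 0) * v 1) / star (v 1)] with hw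
    have hw0 : w ≠ 0 := fun h => h0 (congrFun h 0)
    have hwn : ‖w 2‖ = ‖v 2‖ := by
      change ‖-(star (v 0) * v 1) / star (v 1)‖ = _
      rw [norm_div, norm_neg, norm_mul, norm_star, norm_star, ← h12, h01',
        mul_div_cancel_right₀ _ (norm_ne_zero_iff.2 h1)]
    have hwl : ofVec w ∈ mu2 ⁻¹' {-1 / 6} := by
      rw [ofVec_mem_level_iff hw0, hwn]
      exact hl
    refine ⟨⟨ofVec w, hwl⟩, ?_, ?_⟩
    · refine mem_lagrangianL2_of_conj_relation (v := w) h0 h1 ?_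
      change v 0 * star (v 1) + v 1 * star (-(star (v 0) * v 1) / star (v 1)) = 0
      simp
      field_simp
      simp
    · apply Quotient.sound
      rw [ofVec_of_ne_zero hv] at hp
      rw [ofVec_of_ne_zero hw0] at hwl
      obtain ⟨g, hg⟩ := exists_rotate hw0 hv hwl hp 1 one_ne_zero (by simp [hw]) (by simp [hw])
      refine ⟨g, ?_⟩
      change g • ofVec v = ofVec w
      rw [ofVec_of_ne_zero hv, ofVec_of_ne_zero hw0, hg]

theorem isOneToOneTransverseLifting_lagrangianL2 :
    IsOneToOneTransverseLifting (fubiniStudy 2) mu2 (-1 / 6) lagrangianL2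
      (muRed ⁻¹' {-1 / 6}) where
  isCompact := isCompact_lagrangianL2
  isLagrangian := isLagrangian_lagrangianL2
  transverse := by
    rw [finrank_real_pi_complex, Module.finrank_self]
    exact intersectTransversally_lagrangianL2
  injOn := injOn_orbitProj_lagrangianL2
  eq_image := image_lagrangianL2_eq.symm

theorem isGreatCircle_image_middle_level :
    IsGreatCircle (reducedHomeomorph '' (muRed ⁻¹' {-1 / 6})) := by
  -- The normal is the third axis: the third Hopf coordinate is proportional to |z₀|² - |z₁|².
  refine ⟨EuclideanSpace.single 2 1, by simp, ?_⟩
  rw [reducedHomeomorph.image_eq_preimage_symm]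
  ext q
  obtain ⟨y, rfl⟩ := reducedHomeomorph.surjective q
  obtain ⟨⟨p, hp⟩, rfl⟩ := exists_orbitProj_eq y
  rw [mem_preimage, Homeomorph.symm_apply_apply]
  obtain ⟨v, hv, rfl⟩ := exists_eq_ofVec p
  have hl := (ofVec_mem_level_iff hv).1 hp
  have hhead := head_ne_zero_of_level v hv (by rwa [← ofVec_of_ne_zero hv])
  have hN : ‖v 0‖ ^ 2 + ‖v 1‖ ^ 2 ≠ 0 := by
    rw [hl]
    simpa using level_last_ne_zero hv hl
  have hr : reducedHomeomorph (orbitProj Circle mu2 (-1 / 6) ⟨ofVec v, hp⟩) =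
      mk ![v 0, v 1] hhead := by
    rw [← forgetLast_mk v hv hhead, ← ofVec_of_ne_zero hv]
    rfl
  change moment 1 (ofVec v) = -1 / 6 ↔ inner ℝ (EuclideanSpace.single 2 1) (hopf _) = 0
  rw [hr, moment_one_eq_middle_iff hv hl, hopf, lift_mk]
  simp [EuclideanSpace.inner_single_left, hN, sub_eq_zero]

theorem range_muRed : range muRed = Icc (-1 / 3) 0 := by
  ext c
  constructor
  · rintro ⟨y, rfl⟩
    obtain ⟨⟨p, hp⟩, rfl⟩ := exists_orbitProj_eq y
    obtain ⟨v, hv, rfl⟩ := exists_eq_ofVec p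
    have hl := (ofVec_mem_level_iff hv).1 hp
    change moment 1 (ofVec v) ∈ _
    rw [moment_one_of_level hv hl]
    have h0 : 0 ≤ ‖v 1‖ ^ 2 / (‖v 0‖ ^ 2 + ‖v 1‖ ^ 2) := by positivity
    have h1 : ‖v 1‖ ^ 2 / (‖v 0‖ ^ 2 + ‖v 1‖ ^ 2) ≤ 1 :=
      div_le_one_of_le₀ (le_add_of_nonneg_left (by positivity)) (by positivity)
    constructor <;> linarith
  · rintro ⟨h1, h2⟩
    -- With |z₀|² + |z₁|² = 1 the value c requires |z₁|² = -3c and |z₀|² = 1 + 3c, both nonnegative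
    -- exactly for c in [-1/3, 0]; the level forces |z₂|² = 1/2.
    set v : Fin 3 → ℂ := ![(Real.sqrt (1 + 3 * c) : ℝ), (Real.sqrt (-3 * c) : ℝ),
      (Real.sqrt (1 / 2) : ℝ)] with hvdef
    have hs : ∀ x : ℝ, 0 ≤ x → ‖((Real.sqrt x : ℝ) : ℂ)‖ ^ 2 = x := fun x hx => by
      rw [Complex.norm_real, Real.norm_eq_abs, sq_abs, Real.sq_sqrt hx]
    have n0 : ‖v 0‖ ^ 2 = 1 + 3 * c := hs _ (by linarith)
    have n1 : ‖v 1‖ ^ 2 = -3 * c := hs _ (by linarith)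
    have n2 : ‖v 2‖ ^ 2 = 1 / 2 := hs _ (by norm_num)
    have hv : v ≠ 0 := by
      rintro h
      rw [h] at n2
      norm_num at n2
    have hl : ‖v 0‖ ^ 2 + ‖v 1‖ ^ 2 = 2 * ‖v 2‖ ^ 2 := by
      rw [n0, n1, n2]
      ring
    refine ⟨orbitProj Circle mu2 (-1 / 6) ⟨ofVec v, (ofVec_mem_level_iff hv).2 hl⟩, ?_⟩
    rw [muRed_mk, moment_one_of_level hv hl, n0, n1]
    ring

end

end ChiangLagrangian

theorem mainTheorem1 :
    ∃ ℓ₂ : Set Reduced,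
      IsOneToOneTransverseLifting (fubiniStudy 2) mu2 (-1 / 6) lagrangianL2 ℓ₂ ∧
      IsGreatCircle (reducedHomeomorph '' ℓ₂) ∧
      Set.range muRed = Set.Icc (-1 / 3) 0 ∧
      ℓ₂ = muRed ⁻¹' {-1 / 6} :=
  ⟨_, isOneToOneTransverseLifting_lagrangianL2, isGreatCircle_image_middle_level, range_muRed, rfl⟩
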